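/- Let $l>1$ be an odd integer, $m\ge 3$ an integer, $k=2^{m-2}$ and $n=kl$. Let $p$ be a prime with $p\equiv 1 \pmod l$, let $\zeta_p=e^{2\pi i/p}$, let $r$ be a primitive root modulo $p$, and let $\sigma$ be the automorphism of $\mathbb{Q}(\zeta_p)$ with $\sigma(\zeta_p)=\zeta_p^r$. Let $\mathbb{K}$ be the fixed field of $\langle\sigma^l\rangle$ in $\mathbb{Q}(\zeta_p)$. Let $\lambda$ be an integer with $\lambda(r-1)\equiv 1\pmod p$ and put $$\alpha=\prod_{j=0}^{(p-3)/2}\bigl(1-\zeta_p^{r^j}\bigr),\quad z=\zeta_p^{\lambda}\alpha(1-\zeta_p),\quad x=\mathrm{Tr}_{\mathbb{Q}(\zeta_p)/\mathbb{K}}(z),\quad I=\langle x,\sigma(x),\ldots,\sigma^{l-1}(x)\rangle_{\mathbb{Z}}.$$ Let $\omega=e^{2\pi i/2^m}$, $\theta=\omega+\omega^{-1}$, $\mathbb{L}=\mathbb{Q}(\theta)$, let $\mathbb{KL}$ be the compositum of $\mathbb{K}$ and $\mathbb{L}$ in $\mathbb{C}$, and let $\mathcal{I}=I\mathcal{O}_{\mathbb{L}}\subset\mathbb{KL}$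 be the set of finite sums of products $ab$ with $a\in I$ and $b\in\mathcal{O}_{\mathbb{L}}$. Put $\beta=p^{-2}\left(\frac1k-\frac{\theta}{2k}\right)$. Suppose that $\sigma(x)/x\in\mathbb{Z}[\zeta_p]$. Then: 1. $\mathcal{I}$ is an ideal of the ring of integers $\mathcal{O}_{\mathbb{KL}}$, and it is principal, generated by $x$. 2. $\mathbb{KL}$ has degree $n$ over $\mathbb{Q}$ and exactly $n$ embeddings $s_1,\ldots,s_n$ into $\mathbb{R}$. For every ordering of these, with $\varphi_\beta(y)=\bigl(\sqrt{s_1(\beta)}\,s_1(y),\ldots,\sqrt{s_n(\beta)}\,s_n(y)\bigr)$, the set $\varphi_\beta(\mathcal{I})\subset\mathbb{R}^n$ is the image of the lattice $\mathbb{Z}^n$ under a rotation of $\mathbb{R}^n$; it has maximum diversity, that is, each of its nonzero points has all coordinates nonzero; and its minimum product distance is $$\inf\bigl\{|v_1\cdots v_n| : 0\ne v\in\varphi_\beta(\mathcal{I})\bigr\}=p^{\frac{k-n}{2}}\,2^{\frac{l-n(m-1)}{2}}.$$ 3. $|N_{\mathbb{KL}/\mathbb{Q}}(x)|=p^{\frac{n+k}{2}}$.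 -/

import Mathlib

open scoped NumberField IntermediateField

noncomputable section

namespace MixedLattice

/-! ### Lattices in `ℝⁿ` -/

/-- The cubic lattice `ℤⁿ ⊂ ℝⁿ`. -/
def cubicLattice (n : ℕ) : Set (EuclideanSpace ℝ (Fin n)) :=
  {v | ∀ i, ∃ a : ℤ, v i = a}

/-- `Λ₁` is a rotated version of `Λ₂`: it is the image of `Λ₂` under a linear isometry of `ℝⁿ` of
determinant `1`. -/
def IsRotatedVersion {n : ℕ} (Λ₁ Λ₂ : Set (EuclideanSpace ℝ (Fin n))) : Prop :=
  ∃ R : EuclideanSpace ℝ (Fin n) ≃ₗᵢ[ℝ] EuclideanSpace ℝ (Fin n),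
    LinearMap.det (R.toLinearEquiv : EuclideanSpace ℝ (Fin n) →ₗ[ℝ] EuclideanSpace ℝ (Fin n)) = 1 ∧
      Λ₁ = R '' Λ₂

/-- Maximum diversity: the nonzero points of `Λ` have no zero coordinate. -/
def HasMaximumDiversity {n : ℕ} (Λ : Set (EuclideanSpace ℝ (Fin n))) : Prop :=
  ∀ v ∈ Λ, v ≠ 0 → ∀ i, v i ≠ 0

/-- The minimum product distance `inf {|v₁ ⋯ vₙ| : 0 ≠ v ∈ Λ}`. -/
def minProductDistance {n : ℕ} (Λ : Set (EuclideanSpace ℝ (Fin n))) : ℝ :=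
  sInf {d | ∃ v ∈ Λ, v ≠ 0 ∧ d = |∏ i, v i|}

/-- The twisted homomorphism `φ_β(y) = (√(s₁ β) s₁(y), …, √(sₙ β) sₙ(y))`, for an enumeration
`s₁, …, sₙ` of the real embeddings of `F`. -/
def twistedHom {F : Type*} [Field F] {n : ℕ} (s : Fin n ≃ (F →+* ℝ)) (β y : F) :
    EuclideanSpace ℝ (Fin n) :=
  WithLp.toLp 2 fun i => √(s i β) * s i y

/-- The algebraic lattice `φ_β(M) ⊂ ℝⁿ`. -/
def algebraicLattice {F : Type*} [Field F] {n : ℕ} (s : Fin n ≃ (F →+* ℝ)) (β : F)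
    (M : Submodule ℤ F) : Set (EuclideanSpace ℝ (Fin n)) :=
  twistedHom s β '' (M : Set F)

/-! ### The cyclotomic fields, as subfields of `ℂ` -/

/-- `e^{2πi/N}`. -/
def zeta (N : ℕ) : ℂ := Complex.exp (2 * Real.pi * Complex.I / N)

/-- `ℚ(ζ_N) ⊂ ℂ`. -/
abbrev cyclo (N : ℕ) : IntermediateField ℚ ℂ := ℚ⟮zeta N⟯

/-- `ζ_N` as an element of `ℚ(ζ_N)`. -/
def zetaGen (N : ℕ) : cyclo N := IntermediateField.AdjoinSimple.gen ℚ (zeta N)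

/-! ### The field `𝕂`, the element `x` and the `ℤ`-module `I` -/

/-- `α = ∏_{j < (p-1)/2} (1 - ζ_p^{r^j})`. -/
def alphaElt (p r : ℕ) : cyclo p :=
  ∏ j ∈ Finset.range ((p - 1) / 2), (1 - zetaGen p ^ (r ^ j))

/-- `z = ζ_p^λ α (1 - ζ_p)`. -/
def zElt (p r : ℕ) (lam : ℤ) : cyclo p :=
  zetaGen p ^ lam * alphaElt p r * (1 - zetaGen p)

/-- The fixed field of `⟨σ^l⟩`, inside `ℚ(ζ_p)`. -/
abbrev fixedK {p : ℕ} (l : ℕ) (σ : cyclo p ≃ₐ[ℚ] cyclo p) : IntermediateField ℚ (cyclo p) :=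
  IntermediateField.fixedField (Subgroup.zpowers (σ ^ l))

/-- The same field `𝕂`, as a subfield of `ℂ`. -/
abbrev fieldK {p : ℕ} (l : ℕ) (σ : cyclo p ≃ₐ[ℚ] cyclo p) : IntermediateField ℚ ℂ :=
  IntermediateField.lift (fixedK l σ)

/-- `x = Tr_{ℚ(ζ_p)/𝕂}(z)`. -/
def xElt {p : ℕ} (l r : ℕ) (lam : ℤ) (σ : cyclo p ≃ₐ[ℚ] cyclo p) : fixedK l σ :=
  Algebra.trace (fixedK l σ) (cyclo p) (zElt p r lam)

theorem pow_apply_mem_fixedK {p : ℕ} (l : ℕ) (σ : cyclo p ≃ₐ[ℚ] cyclo p) (i : ℕ)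
    (y : fixedK l σ) : (σ ^ i) (y : cyclo p) ∈ fixedK l σ := by
  rw [IntermediateField.mem_fixedField_iff]
  intro f hf
  have hy := (IntermediateField.mem_fixedField_iff _ _).1 y.2 f hf
  obtain ⟨t, rfl⟩ := Subgroup.mem_zpowers_iff.1 hf
  have hc : Commute ((σ ^ l) ^ t) (σ ^ i) :=
    (((Commute.refl σ).pow_left l).zpow_left t).pow_right i
  have h := congrArg (fun g : cyclo p ≃ₐ[ℚ] cyclo p => g (y : cyclo p)) hc.eq
  simp only [AlgEquiv.mul_apply] at h
  rw [h, hy]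

/-- `σ^i(x)`, as an element of `𝕂 ⊂ ℂ`. -/
def conjX {p : ℕ} (l r : ℕ) (lam : ℤ) (σ : cyclo p ≃ₐ[ℚ] cyclo p) (i : ℕ) : fieldK l σ :=
  ⟨(((σ ^ i) (xElt l r lam σ : cyclo p) : cyclo p) : ℂ),
    (IntermediateField.mem_lift _).2 (pow_apply_mem_fixedK l σ i _)⟩

/-- `I = ⟨x, σ(x), …, σ^{l-1}(x)⟩_ℤ ⊂ 𝕂`. -/
def moduleI {p : ℕ} (l r : ℕ) (lam : ℤ) (σ : cyclo p ≃ₐ[ℚ] cyclo p) :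
    Submodule ℤ (fieldK l σ) :=
  Submodule.span ℤ (Set.range fun i : Fin l => conjX l r lam σ i)

/-! ### The field `𝕃` and the compositum -/

/-- `θ = ω + ω⁻¹` with `ω = e^{2πi/2^m}`. -/
def theta (m : ℕ) : ℂ := zeta (2 ^ m) + (zeta (2 ^ m))⁻¹

/-- `𝕃 = ℚ(θ)`. -/
abbrev fieldL (m : ℕ) : IntermediateField ℚ ℂ := ℚ⟮theta m⟯

/-- The compositum `𝕂𝕃`. -/
abbrev fieldKL {p : ℕ} (l m : ℕ) (σ : cyclo p ≃ₐ[ℚ] cyclo p) : IntermediateField ℚ ℂ :=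
  fieldK l σ ⊔ fieldL m

/-- The inclusion `𝕂 ⊂ 𝕂𝕃`. -/
def inclK {p : ℕ} (l m : ℕ) (σ : cyclo p ≃ₐ[ℚ] cyclo p) : fieldK l σ →ₐ[ℚ] fieldKL l m σ :=
  IntermediateField.inclusion le_sup_left

/-- The inclusion `𝕃 ⊂ 𝕂𝕃`. -/
def inclL {p : ℕ} (l m : ℕ) (σ : cyclo p ≃ₐ[ℚ] cyclo p) : fieldL m →ₐ[ℚ] fieldKL l m σ :=
  IntermediateField.inclusion le_sup_right

/-- A field seen inside an extension, as a `ℤ`-linear map. -/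
def asIntLinear {A B : Type*} [Field A] [Field B] [Algebra ℚ A] [Algebra ℚ B] (f : A →ₐ[ℚ] B) :
    A →ₗ[ℤ] B :=
  (f : A →+ B).toIntLinearMap

/-- The ring of integers of `F`, as a `ℤ`-submodule of `F`. -/
def integersModule (F : Type*) [Field F] : Submodule ℤ F :=
  Subalgebra.toSubmodule (integralClosure ℤ F)

/-- `x` as an element of `𝕂𝕃`. -/
def xKL {p : ℕ} (l r m : ℕ) (lam : ℤ) (σ : cyclo p ≃ₐ[ℚ] cyclo p) : fieldKL l m σ :=
  inclK l m σ (conjX l r lam σ 0)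

/-- `𝓘 = I · O_𝕃 ⊂ 𝕂𝕃`, the set of finite sums of products `a b` with `a ∈ I` and `b ∈ O_𝕃`. -/
def moduleIOL {p : ℕ} (l r m : ℕ) (lam : ℤ) (σ : cyclo p ≃ₐ[ℚ] cyclo p) :
    Submodule ℤ (fieldKL l m σ) :=
  (moduleI l r lam σ).map (asIntLinear (inclK l m σ)) *
    (integersModule (fieldL m)).map (asIntLinear (inclL l m σ))

/-- `θ` as an element of `𝕂𝕃`. -/
def thetaKL {p : ℕ} (l m : ℕ) (σ : cyclo p ≃ₐ[ℚ] cyclo p) : fieldKL l m σ :=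
  inclL l m σ (IntermediateField.AdjoinSimple.gen ℚ (theta m))

/-- `β = p⁻² (1/k - θ/(2k))` with `k = 2^{m-2}`. -/
def betaKL {p : ℕ} (l m : ℕ) (σ : cyclo p ≃ₐ[ℚ] cyclo p) : fieldKL l m σ :=
  ((p : fieldKL l m σ) ^ 2)⁻¹ *
    (1 / ((2 ^ (m - 2) : ℕ) : fieldKL l m σ) -
      thetaKL l m σ / (2 * ((2 ^ (m - 2) : ℕ) : fieldKL l m σ)))

/-- The `ℤ`-submodule `M` of `F` is (the underlying group of) an ideal of the ring of integers
`O_F`, principal and generated by `x`. -/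
def IsPrincipalIdealGeneratedBy {F : Type*} [Field F] (M : Submodule ℤ F) (x : F) : Prop :=
  ∃ g : 𝓞 F, (g : F) = x ∧
    (M : Set F) = (fun y : 𝓞 F => (y : F)) '' (Ideal.span {g} : Ideal (𝓞 F))

end MixedLattice

end

/-! The lattice is cubic because `𝓘` has an explicit `ℤ`-basis that is orthonormal for the form
Tr(βuv), built from one orthogonal system in `𝕂` and one in `𝕃`.

In `𝕂`: write p = 2cl + 1. The product g = ζ^λ α satisfies σ(g) = -g and g² = (-1)^c p. Hence x =
-gη, where η is the alternating period Σ (-1)^i ζ^(r^(li)), and traces of powers of ζ give Tr(σ^i(x)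
σ^j(x)) = p² δ_ij (`trace_conj_mul_conj`). Since 1 - ζ divides η and x² = ±pη², Tr(x²W) lies in p²ℤ
for every integer W (`trace_sq_traceElt_mul`).

In `𝕃`: the sums s_j = ω^(-j) + ⋯ + ω^j, 0 ≤ j < k, are orthogonal of square length 2k for the form
Tr((2 - θ)uv) (`trace_oddSum`), and Tr((2 - θ)W) lies in 2kℤ for every integer W
(`exists_trace_two_sub_mul`).

The degrees l (odd) and k (a power of 2) are coprime, so traces multiply in the compositum and the
products σ^i(x) s_j are orthonormal for β = p⁻²(2 - θ)/(2k). If σ(x)/x is integral, these products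
are multiples of x. Conversely, the coordinates of an integral multiple of x become integers after
multiplication by 2k and also by p², hence are integers. So the products span exactly the ideal (x)
(`mem_span_prodBasis_iff`).

Orthonormality together with total reality and β totally positive gives the isometry with ℤⁿ, and
the least product is √N(β) |N(x)|, attained at x. The norm of x reduces to |N(η²)| = p
(`norm_periodSq`): η² divides p, so this norm is a power of p. Exponent 0 is excluded because 1 - ζ
divides η. Exponent at least 2 would put x/N(1 - ζ), the norm being taken down to `𝕂`, in the span
of the σ^i(x), which consists of integral multiples of x. -/

/-! ### Automorphisms, traces and norms of the prime cyclotomic field -/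

/-- A sum over a cyclic group is a sum over the powers of a generator. -/
theorem sum_univ_eq_sum_range_pow {G M : Type*} [Group G] [Fintype G] [AddCommMonoid M] {g : G}
    (hg : ∀ x, x ∈ Subgroup.zpowers g) (f : G → M) :
    ∑ x, f x = ∑ i ∈ Finset.range (orderOf g), f (g ^ i) := by
  classical
  rw [← IsCyclic.image_range_orderOf hg, Finset.sum_image]
  intro a ha b hb hab
  exact pow_injOn_Iio_orderOf (by simpa using ha) (by simpa using hb) hab

theorem prod_univ_eq_prod_range_pow {G M : Type*} [Group G] [Fintype G] [CommMonoid M] {g : G}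
    (hg : ∀ x, x ∈ Subgroup.zpowers g) (f : G → M) :
    ∏ x, f x = ∏ i ∈ Finset.range (orderOf g), f (g ^ i) :=
  sum_univ_eq_sum_range_pow (M := Additive M) hg f

/-- A rational number which is integral over `ℤ` is an integer. -/
theorem exists_int_of_isIntegral {q : ℚ} (hq : IsIntegral ℤ q) : ∃ a : ℤ, q = a := by
  obtain ⟨a, ha⟩ := IsIntegrallyClosed.isIntegral_iff.1 hq
  exact ⟨a, by simpa using ha.symm⟩

/-- `ζ` is a primitive `p`-th root of unity, `p = 2cl + 1`, and `σ` is the automorphism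
`ζ ↦ ζ ^ r` for a primitive root `r` modulo `p`. -/
structure CyclicSetup (p l c r : ℕ) {P : Type*} [Field P] [CharZero P] (ζ : P)
    (σ : P ≃ₐ[ℚ] P) : Prop where
  prime : p.Prime
  eq : p = 2 * c * l + 1
  odd : Odd l
  one_lt : 1 < l
  order : orderOf (r : ZMod p) = p - 1
  prim : IsPrimitiveRoot ζ p
  map_zeta : σ ζ = ζ ^ r

namespace CyclicSetup

open Finset

variable {p l c r : ℕ} {P : Type*} [Field P] [NumberField P] {ζ : P} {σ : P ≃ₐ[ℚ] P}

theorem pos (S : CyclicSetup p l c r ζ σ) : 0 < p := S.prime.pos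

theorem c_pos (S : CyclicSetup p l c r ζ σ) : 0 < c := by
  rcases Nat.eq_zero_or_pos c with h | h
  · have := S.eq; have := S.prime.one_lt; subst h; omega
  · exact h

theorem l_pos (S : CyclicSetup p l c r ζ σ) : 0 < l := by have := S.one_lt; omega

theorem sub_one (S : CyclicSetup p l c r ζ σ) : p - 1 = 2 * c * l := by have := S.eq; omega

theorem ne_two (S : CyclicSetup p l c r ζ σ) : p ≠ 2 := by
  have h := S.eq
  rw [mul_assoc] at h
  omega

theorem sigma_pow_zeta (S : CyclicSetup p l c r ζ σ) (i : ℕ) : (σ ^ i) ζ = ζ ^ (r ^ i) := by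
  induction i with
  | zero => simp
  | succ i ih => rw [pow_succ', AlgEquiv.mul_apply, ih, map_pow, S.map_zeta, ← pow_mul, ← pow_succ']

theorem zeta_pow_eq_iff (S : CyclicSetup p l c r ζ σ) (a b : ℕ) :
    ζ ^ a = ζ ^ b ↔ (a : ZMod p) = b := by
  have : NeZero p := ⟨S.pos.ne'⟩
  have h := S.prim.isUnit_unit S.pos.ne'
  rw [ZMod.natCast_eq_natCast_iff, h.eq_orderOf, ← pow_eq_pow_iff_modEq, Units.ext_iff]
  simp

theorem one_sub_ne_zero (S : CyclicSetup p l c r ζ σ) : 1 - ζ ≠ 0 :=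
  sub_ne_zero.2 (S.prim.ne_one S.prime.one_lt).symm

theorem isIntegral_zeta (S : CyclicSetup p l c r ζ σ) : IsIntegral ℤ ζ := S.prim.isIntegral S.pos

theorem isIntegral_sigma (y : P) (g : P ≃ₐ[ℚ] P) (hy : IsIntegral ℤ y) : IsIntegral ℤ (g y) :=
  hy.map (g.toAlgHom.restrictScalars ℤ)

theorem isIntegral_one_sub_pow_div (S : CyclicSetup p l c r ζ σ) (a : ℕ) :
    IsIntegral ℤ ((1 - ζ ^ a) / (1 - ζ)) := by
  rw [← neg_sub (ζ ^ a), ← neg_sub ζ, neg_div_neg_eq, ← geom_sum_eq (sub_ne_zero.1 (by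
    rw [← neg_sub]; exact neg_ne_zero.2 S.one_sub_ne_zero))]
  exact IsIntegral.sum _ fun i _ => S.isIntegral_zeta.pow i

theorem isIntegral_sigma_pow_one_sub_div (S : CyclicSetup p l c r ζ σ) (i : ℕ) :
    IsIntegral ℤ ((σ ^ i) (1 - ζ) / (1 - ζ)) := by
  rw [map_sub, map_one, S.sigma_pow_zeta]
  exact S.isIntegral_one_sub_pow_div _

/-- Divisibility by `1 - ζ` is stable under conjugation. -/
theorem isIntegral_sigma_div (S : CyclicSetup p l c r ζ σ) {y : P}
    (hy : IsIntegral ℤ (y / (1 - ζ))) (i : ℕ) : IsIntegral ℤ ((σ ^ i) y / (1 - ζ)) := by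
  have h := (isIntegral_sigma _ (σ ^ i) hy).mul (S.isIntegral_sigma_pow_one_sub_div i)
  rw [map_div₀, div_mul_div_cancel₀] at h
  · exact h
  · exact (map_ne_zero (σ ^ i)).2 S.one_sub_ne_zero

variable [IsCyclotomicExtension {p} ℚ P]

theorem ext_zeta (S : CyclicSetup p l c r ζ σ) {f g : P ≃ₐ[ℚ] P} (h : f ζ = g ζ) : f = g := by
  have : NeZero p := ⟨S.pos.ne'⟩
  have h2 : f.toAlgHom = g.toAlgHom := (S.prim.powerBasis ℚ).algHom_ext (by simpa using h)
  ext y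
  exact DFunLike.congr_fun h2 y

theorem sigma_pow_eq_one_iff (S : CyclicSetup p l c r ζ σ) (i : ℕ) :
    σ ^ i = 1 ↔ (r : ZMod p) ^ i = 1 := by
  have h := S.zeta_pow_eq_iff (r ^ i) 1
  rw [pow_one, ← S.sigma_pow_zeta] at h
  push_cast at h
  rw [← h]
  exact ⟨fun h => by simp [h], fun h => S.ext_zeta (by simpa using h)⟩

theorem orderOf_sigma (S : CyclicSetup p l c r ζ σ) : orderOf σ = p - 1 := by
  rw [← S.order]
  exact orderOf_eq_orderOf_iff.2 S.sigma_pow_eq_one_iff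

theorem finrank_eq (S : CyclicSetup p l c r ζ σ) : Module.finrank ℚ P = p - 1 := by
  have : NeZero p := ⟨S.pos.ne'⟩
  rw [IsCyclotomicExtension.finrank P (Polynomial.cyclotomic.irreducible_rat S.pos),
    Nat.totient_prime S.prime]

theorem isGalois (_S : CyclicSetup p l c r ζ σ) : IsGalois ℚ P :=
  IsCyclotomicExtension.isGalois {p} ℚ P

theorem mem_zpowers (S : CyclicSetup p l c r ζ σ) (g : P ≃ₐ[ℚ] P) : g ∈ Subgroup.zpowers σ := by
  have := S.isGalois
  have h : Subgroup.zpowers σ = ⊤ := by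
    apply Subgroup.eq_top_of_card_eq
    rw [Nat.card_zpowers, S.orderOf_sigma, IsGalois.card_aut_eq_finrank, S.finrank_eq]
  simp [h]

theorem trace_eq (S : CyclicSetup p l c r ζ σ) (y : P) :
    algebraMap ℚ P (Algebra.trace ℚ P y) = ∑ i ∈ range (p - 1), (σ ^ i) y := by
  have := S.isGalois
  rw [trace_eq_sum_automorphisms, sum_univ_eq_sum_range_pow S.mem_zpowers, S.orderOf_sigma]

theorem norm_eq (S : CyclicSetup p l c r ζ σ) (y : P) :
    algebraMap ℚ P (Algebra.norm ℚ y) = ∏ i ∈ range (p - 1), (σ ^ i) y := by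
  have := S.isGalois
  rw [Algebra.norm_eq_prod_automorphisms, prod_univ_eq_prod_range_pow S.mem_zpowers,
    S.orderOf_sigma]

theorem norm_one_sub (S : CyclicSetup p l c r ζ σ) : Algebra.norm ℚ (1 - ζ) = p := by
  have : Fact p.Prime := ⟨S.prime⟩
  have h := S.prim.norm_sub_one_of_prime_ne_two' (K := ℚ)
    (Polynomial.cyclotomic.irreducible_rat S.pos) S.ne_two
  rw [← neg_sub ζ 1, ← neg_one_mul, map_mul, h]
  -- The degree p - 1 = 2cl is even, so N(-1) = 1 and the sign can be dropped.
  have h2 := Algebra.norm_algebraMap (R := ℚ) (S := P) (-1)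
  rw [S.finrank_eq, S.sub_one, mul_assoc, pow_mul, map_neg, map_one] at h2
  simp [h2]

/-- Taking norms turns divisibility by 1 - ζ into p ∣ a^(p-1). This is how divisibility upstairs
becomes divisibility of rational integers. -/
theorem dvd_of_isIntegral (S : CyclicSetup p l c r ζ σ) {a : ℤ}
    (ha : IsIntegral ℤ ((a : P) / (1 - ζ))) : (p : ℤ) ∣ a := by
  obtain ⟨b, hb⟩ := exists_int_of_isIntegral (Algebra.isIntegral_norm ℚ ha)
  have h2 := Algebra.norm_algebraMap (R := ℚ) (S := P) (a : ℚ)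
  rw [map_intCast, ← div_mul_cancel₀ (a : P) S.one_sub_ne_zero, map_mul, hb, S.norm_one_sub] at h2
  exact (Nat.prime_iff_prime_int.1 S.prime).dvd_of_dvd_pow (n := Module.finrank ℚ P)
    ⟨b, by rw [mul_comm]; exact_mod_cast h2.symm⟩

end CyclicSetup

/-! ### The fixed field of σ^l and its traces -/

/-- A sum over `range (n * l)` of an `l`-periodic function. -/
theorem sum_range_mul_of_periodic {M : Type*} [AddCommMonoid M] {f : ℕ → M} {l : ℕ}
    (hf : ∀ i, f (i + l) = f i) (n : ℕ) :
    ∑ i ∈ Finset.range (n * l), f i = n • ∑ i ∈ Finset.range l, f i := by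
  have h : ∀ n i, f (n * l + i) = f i := by
    intro n i
    induction n with
    | zero => simp
    | succ n ih => rw [← ih, ← hf (n * l + i)]; congr 1; ring
  induction n with
  | zero => simp
  | succ n ih =>
    rw [Nat.succ_mul, Finset.sum_range_add, ih, succ_nsmul]
    simp_rw [h]

namespace CyclicSetup

open Finset

variable {p l c r : ℕ} {P : Type*} [Field P] [NumberField P] {ζ : P} {σ : P ≃ₐ[ℚ] P}

variable (l σ) in
/-- The fixed field of `⟨σ ^ l⟩`. -/
abbrev fixed : IntermediateField ℚ P :=
  IntermediateField.fixedField (Subgroup.zpowers (σ ^ l))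

theorem mem_fixed_iff {y : P} : y ∈ fixed l σ ↔ (σ ^ l) y = y := by
  rw [IntermediateField.mem_fixedField_iff]
  refine ⟨fun h => h _ (Subgroup.mem_zpowers _), fun h f hf => ?_⟩
  have h2 : Subgroup.zpowers (σ ^ l) ≤ MulAction.stabilizer (P ≃ₐ[ℚ] P) y :=
    Subgroup.zpowers_le.2 (MulAction.mem_stabilizer_iff.2 h)
  exact MulAction.mem_stabilizer_iff.1 (h2 hf)

theorem sigma_add_fixed (y : fixed l σ) (i : ℕ) : (σ ^ (i + l)) (y : P) = (σ ^ i) y := by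
  rw [pow_add, AlgEquiv.mul_apply, mem_fixed_iff.1 y.2]

theorem sigma_mem_fixed {y : P} (hy : y ∈ fixed l σ) (i : ℕ) : (σ ^ i) y ∈ fixed l σ := by
  rw [mem_fixed_iff, ← AlgEquiv.mul_apply, ← pow_add, add_comm, sigma_add_fixed ⟨y, hy⟩]

theorem pow_half (S : CyclicSetup p l c r ζ σ) : (r : ZMod p) ^ (c * l) = -1 := by
  have : Fact p.Prime := ⟨S.prime⟩
  have h : ((r : ZMod p) ^ (c * l)) ^ 2 = 1 := by
    rw [← pow_mul, ← pow_orderOf_eq_one (r : ZMod p), S.order, S.sub_one]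
    congr 1; ring
  rcases _root_.sq_eq_one_iff.1 h with h | h
  · exfalso
    have h2 := Nat.le_of_dvd (Nat.mul_pos S.c_pos S.l_pos) (orderOf_dvd_of_pow_eq_one h)
    rw [S.order, S.sub_one] at h2
    nlinarith [Nat.mul_pos S.c_pos S.l_pos]
  · exact h

variable [IsCyclotomicExtension {p} ℚ P]

theorem orderOf_sigma_pow (S : CyclicSetup p l c r ζ σ) : orderOf (σ ^ l) = 2 * c := by
  rw [orderOf_pow_of_dvd S.l_pos.ne' ⟨2 * c, by rw [S.orderOf_sigma, S.sub_one, mul_comm]⟩,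
    S.orderOf_sigma, S.sub_one, Nat.mul_div_cancel _ S.l_pos]

theorem finrank_fixed_top (S : CyclicSetup p l c r ζ σ) :
    Module.finrank (fixed l σ) P = 2 * c := by
  rw [IntermediateField.finrank_fixedField_eq_card, Nat.card_zpowers, S.orderOf_sigma_pow]

theorem finrank_fixed (S : CyclicSetup p l c r ζ σ) : Module.finrank ℚ (fixed l σ) = l := by
  have h := Module.finrank_mul_finrank ℚ (fixed l σ) P
  rw [S.finrank_fixed_top, S.finrank_eq, S.sub_one, mul_comm] at h
  exact Nat.eq_of_mul_eq_mul_left (by have := S.c_pos; omega) h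

/-- The trace down to the fixed field, as a sum over the powers of `σ ^ l`. -/
theorem coe_trace_fixed (S : CyclicSetup p l c r ζ σ) (y : P) :
    (Algebra.trace (fixed l σ) P y : P) = ∑ i ∈ range (2 * c), (σ ^ (l * i)) y := by
  have := S.isGalois
  set e := IntermediateField.subgroupEquivAlgEquiv (Subgroup.zpowers (σ ^ l))
  set g : Subgroup.zpowers (σ ^ l) := ⟨σ ^ l, Subgroup.mem_zpowers _⟩
  have hg : ∀ x, x ∈ Subgroup.zpowers g := by
    rintro ⟨x, n, rfl⟩
    exact ⟨n, Subtype.ext (by simp [g])⟩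
  have ho : orderOf g = 2 * c := by
    rw [← S.orderOf_sigma_pow]; exact Subgroup.orderOf_mk _ _
  have h := trace_eq_sum_automorphisms (K := fixed l σ) y
  rw [← e.toEquiv.sum_comp, sum_univ_eq_sum_range_pow hg, ho] at h
  refine h.trans (sum_congr rfl fun i _ => ?_)
  rw [pow_mul]
  rfl

theorem trace_eq_mul_trace_fixed (S : CyclicSetup p l c r ζ σ) (y : fixed l σ) :
    Algebra.trace ℚ P (y : P) = (2 * c) * Algebra.trace ℚ (fixed l σ) y := by
  have htt := Algebra.trace_trace (R := ℚ) (S := fixed l σ) (T := P) (y : P)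
  rw [← htt]
  have h : Algebra.trace (fixed l σ) P (y : P) = (2 * c) • y := by
    rw [← S.finrank_fixed_top]
    exact Algebra.trace_algebraMap (S := P) y
  rw [h, map_nsmul, nsmul_eq_mul]
  push_cast
  rfl

theorem norm_eq_norm_fixed_pow (S : CyclicSetup p l c r ζ σ) (y : fixed l σ) :
    Algebra.norm ℚ (y : P) = (Algebra.norm ℚ y) ^ (2 * c) := by
  rw [← Algebra.norm_norm (S := fixed l σ)]
  have h : Algebra.norm (fixed l σ) (y : P) = y ^ (2 * c) := by
    rw [← S.finrank_fixed_top]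
    exact Algebra.norm_algebraMap (S := P) y
  rw [h, map_pow]

/-- The trace of the fixed field, as a sum over `1, σ, …, σ ^ (l - 1)`. -/
theorem trace_fixed_eq (S : CyclicSetup p l c r ζ σ) (y : fixed l σ) :
    algebraMap ℚ P (Algebra.trace ℚ (fixed l σ) y) = ∑ i ∈ range l, (σ ^ i) (y : P) := by
  have h := S.trace_eq (y : P)
  rw [S.trace_eq_mul_trace_fixed, S.sub_one, sum_range_mul_of_periodic (sigma_add_fixed y),
    nsmul_eq_mul, map_mul] at h
  have hc : ((2 * c : ℕ) : P) ≠ 0 := by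
    have := S.c_pos
    exact_mod_cast (by omega : 2 * c ≠ 0)
  apply mul_left_cancel₀ hc
  rw [← h]
  simp

theorem trace_zeta_pow (S : CyclicSetup p l c r ζ σ) (a : ℕ) :
    Algebra.trace ℚ P (ζ ^ a) = if (a : ZMod p) = 0 then (p : ℚ) - 1 else -1 := by
  have : NeZero p := ⟨S.pos.ne'⟩
  have h0 : Algebra.trace ℚ P 1 = (p : ℚ) - 1 := by
    have := Algebra.trace_algebraMap (R := ℚ) (S := P) 1
    rw [map_one, S.finrank_eq] at this
    rw [this, nsmul_eq_mul, mul_one, Nat.cast_sub S.prime.one_lt.le, Nat.cast_one]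
  split_ifs with h
  · have h2 := (S.zeta_pow_eq_iff a 0).2 (by simpa using h)
    rw [h2, pow_zero, h0]
  · have hz : IsPrimitiveRoot (ζ ^ a) p := by
      refine S.prim.pow_of_coprime a ((S.prime.coprime_iff_not_dvd.2 fun h2 => h ?_).symm)
      exact (ZMod.natCast_eq_zero_iff _ _).2 h2
    -- For p ∤ a, ζ^a is again a primitive root, so its trace is read off the subleading coefficient
    -- of the p-th cyclotomic polynomial.
    have h2 := (hz.powerBasis ℚ).trace_gen_eq_nextCoeff_minpoly
    rw [IsPrimitiveRoot.powerBasis_gen,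
      ← hz.minpoly_eq_cyclotomic_of_irreducible (Polynomial.cyclotomic.irreducible_rat S.pos)] at h2
    have : Fact p.Prime := ⟨S.prime⟩
    have hp := S.prime.two_le
    rw [h2, Polynomial.nextCoeff_of_natDegree_pos (by
        rw [Polynomial.natDegree_cyclotomic, Nat.totient_prime S.prime]; omega),
      Polynomial.natDegree_cyclotomic, Nat.totient_prime S.prime, Polynomial.cyclotomic_prime,
      Polynomial.finsetSum_coeff]
    simp_rw [Polynomial.coeff_X_pow]
    simp
    omega

end CyclicSetup

/-! ### The square root of ±p, the alternating period and orthogonality -/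

namespace CyclicSetup

open Finset

variable {p l c r : ℕ} {P : Type*} [Field P] [NumberField P] {ζ : P} {σ : P ≃ₐ[ℚ] P} {lam : ℤ}

variable (c l r ζ lam) in
/-- The square root `ζ ^ λ * ∏ (1 - ζ ^ (r ^ j))` of `± p`. -/
noncomputable def gauss : P := ζ ^ lam * ∏ j ∈ range (c * l), (1 - ζ ^ (r ^ j))

variable (c l r ζ) in
/-- The alternating period `∑ (-1) ^ i ζ ^ (r ^ (l i))`. -/
noncomputable def period : P := ∑ i ∈ range (2 * c), (-1) ^ i * ζ ^ (r ^ (l * i))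

theorem zeta_pow_half (S : CyclicSetup p l c r ζ σ) : ζ ^ (r ^ (c * l)) = ζ⁻¹ := by
  apply eq_inv_of_mul_eq_one_left
  rw [← pow_succ, ← pow_zero ζ, S.zeta_pow_eq_iff]
  push_cast
  rw [S.pow_half]
  ring

theorem zeta_ne_zero (S : CyclicSetup p l c r ζ σ) : ζ ≠ 0 := S.prim.ne_zero S.pos.ne'

/-- This is the role of λ: the congruence says λr ≡ λ + 1, so σ multiplies ζ^λ by ζ. -/
theorem zeta_zpow (S : CyclicSetup p l c r ζ σ) (hlam : lam * ((r : ℤ) - 1) ≡ 1 [ZMOD p]) :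
    (ζ ^ r) ^ lam = ζ ^ lam * ζ := by
  obtain ⟨k, hk⟩ := hlam.symm.dvd
  have h : (r : ℤ) * lam = lam + 1 + p * k := by linarith
  rw [← zpow_natCast, ← zpow_mul, h, zpow_add₀ S.zeta_ne_zero, zpow_add₀ S.zeta_ne_zero, zpow_mul,
    zpow_natCast, S.prim.pow_eq_one, one_zpow, mul_one, zpow_one]

/-- Applying σ shifts the product by one index, trading the factor 1 - ζ for 1 - ζ⁻¹ = -ζ⁻¹(1 - ζ);
the extra ζ coming from ζ^λ cancels ζ⁻¹ and leaves the sign. -/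
theorem sigma_gauss (S : CyclicSetup p l c r ζ σ) (hlam : lam * ((r : ℤ) - 1) ≡ 1 [ZMOD p]) :
    σ (gauss l c r ζ lam) = -gauss l c r ζ lam := by
  have h1 := prod_range_succ (fun j => 1 - ζ ^ (r ^ j)) (c * l)
  rw [prod_range_succ', pow_zero, pow_one, S.zeta_pow_half] at h1
  have h2 : σ (∏ j ∈ range (c * l), (1 - ζ ^ (r ^ j))) =
      ∏ j ∈ range (c * l), (1 - ζ ^ (r ^ (j + 1))) := by
    simp [map_prod, S.map_zeta, ← pow_mul, pow_succ']
  rw [gauss, map_mul, h2, map_zpow₀, S.map_zeta, S.zeta_zpow hlam]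
  apply mul_right_cancel₀ S.one_sub_ne_zero
  rw [mul_assoc, h1]
  have := S.zeta_ne_zero
  field_simp
  ring

theorem sigma_pow_gauss (S : CyclicSetup p l c r ζ σ)
    (hlam : lam * ((r : ℤ) - 1) ≡ 1 [ZMOD p]) (i : ℕ) :
    (σ ^ i) (gauss l c r ζ lam) = (-1) ^ i * gauss l c r ζ lam := by
  induction i with
  | zero => simp
  | succ i ih =>
    rw [pow_succ', AlgEquiv.mul_apply, ih, map_mul, S.sigma_gauss hlam]
    simp [pow_succ]

theorem neg_one_pow_mul (S : CyclicSetup p l c r ζ σ) (i : ℕ) :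
    (-1 : P) ^ (l * i) = (-1) ^ i := by
  rw [pow_mul, S.odd.neg_one_pow]

theorem sigma_pow_period (S : CyclicSetup p l c r ζ σ) (b : ℕ) :
    (σ ^ b) (period l c r ζ) = ∑ i ∈ range (2 * c), (-1) ^ i * ζ ^ (r ^ (l * i + b)) := by
  rw [period, map_sum]
  refine sum_congr rfl fun i _ => ?_
  rw [map_mul, map_pow, map_pow, S.sigma_pow_zeta, ← pow_mul, ← pow_add, map_neg, map_one,
    add_comm]

/-- The 2c signs sum to zero, so each power of ζ in the period may be replaced by its difference
from 1. -/
theorem isIntegral_period_div (S : CyclicSetup p l c r ζ σ) :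
    IsIntegral ℤ (period l c r ζ / (1 - ζ)) := by
  have h : period l c r ζ = ∑ i ∈ range (2 * c), -((-1) ^ i * (1 - ζ ^ (r ^ (l * i)))) := by
    have h2 : ∑ i ∈ range (2 * c), (-1 : P) ^ i = 0 := by
      rw [neg_one_geom_sum, if_pos (even_two_mul c)]
    simp_rw [mul_sub, neg_sub, mul_one]
    rw [sum_sub_distrib, h2, sub_zero, period]
  rw [h, sum_div]
  refine IsIntegral.sum _ fun i _ => ?_
  rw [neg_div, mul_div_assoc]
  exact (((isIntegral_one.neg).pow i).mul (S.isIntegral_one_sub_pow_div _)).neg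

/-- Since -1 = r^(cl) and both exponents are below the order p - 1 of r, the congruence forces li +
b = cl; b < l then makes this a division with remainder. -/
theorem pow_eq_half_iff (S : CyclicSetup p l c r ζ σ) {i b : ℕ} (hi : i < 2 * c) (hb : b < l) :
    ((1 + r ^ (l * i + b) : ℕ) : ZMod p) = 0 ↔ b = 0 ∧ i = c := by
  have h1 : l * i + b < 2 * c * l := by nlinarith
  have h2 : c * l < 2 * c * l := by nlinarith [S.c_pos, S.l_pos, Nat.mul_pos S.c_pos S.l_pos]
  push_cast
  rw [add_comm, add_eq_zero_iff_eq_neg, ← S.pow_half]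
  constructor
  · intro h
    have h3 : l * i + b = c * l :=
      pow_injOn_Iio_orderOf (by rwa [S.order, S.sub_one]) (by rwa [S.order, S.sub_one]) h
    have h4 : i = c := by
      rcases lt_trichotomy i c with h5 | h5 | h5
      · nlinarith
      · exact h5
      · nlinarith
    subst h4
    exact ⟨by linarith, rfl⟩
  · rintro ⟨rfl, rfl⟩
    rw [add_zero, mul_comm]

variable [IsCyclotomicExtension {p} ℚ P]

/-- The conjugates of 1 - ζ split into two halves exchanged by σ^(cl), which inverts ζ. So g times
its image under σ^(cl) is N(1 - ζ) = p, while σ^(cl) g = (-1)^c g because l is odd. -/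
theorem gauss_sq (S : CyclicSetup p l c r ζ σ) (hlam : lam * ((r : ℤ) - 1) ≡ 1 [ZMOD p]) :
    gauss l c r ζ lam ^ 2 = (-1) ^ c * p := by
  have h1 := S.norm_eq (1 - ζ)
  rw [S.norm_one_sub, S.sub_one, show 2 * c * l = c * l + c * l by ring, prod_range_add] at h1
  simp_rw [pow_add, AlgEquiv.mul_apply] at h1
  rw [← map_prod] at h1
  have h3 : ∏ i ∈ range (c * l), (σ ^ i) (1 - ζ) = ∏ i ∈ range (c * l), (1 - ζ ^ (r ^ i)) := by
    refine prod_congr rfl fun i _ => ?_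
    rw [map_sub, map_one, S.sigma_pow_zeta]
  have h2 := S.sigma_pow_gauss hlam (c * l)
  rw [h3] at h1
  rw [mul_comm c l, S.neg_one_pow_mul, mul_comm l c] at h2
  have h4 : gauss l c r ζ lam * (σ ^ (c * l)) (gauss l c r ζ lam) = p := by
    have : ζ ^ lam ≠ 0 := zpow_ne_zero _ S.zeta_ne_zero
    rw [gauss, map_mul, map_zpow₀, S.sigma_pow_zeta, S.zeta_pow_half, inv_zpow, mul_mul_mul_comm,
      mul_inv_cancel₀ this, one_mul, ← h1, map_natCast]
  rw [h2] at h4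
  have h5 : ((-1 : P) ^ c) * (-1) ^ c = 1 := by rw [← mul_pow]; simp
  linear_combination (-1) ^ c * h4 - gauss l c r ζ lam ^ 2 * h5

variable (l c r ζ σ lam) in
/-- The trace to the fixed field of `ζ ^ λ * α * (1 - ζ)`. -/
noncomputable def traceElt : fixed l σ := Algebra.trace (fixed l σ) P (gauss l c r ζ lam * (1 - ζ))

/-- As l is odd, σ^(li) acts on g by (-1)^i, so g factors out of the trace; the constant terms
cancel and the alternating period remains. -/
theorem coe_traceElt (S : CyclicSetup p l c r ζ σ) (hlam : lam * ((r : ℤ) - 1) ≡ 1 [ZMOD p]) :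
    (traceElt l c r ζ σ lam : P) = -(gauss l c r ζ lam * period l c r ζ) := by
  have h2 : ∑ i ∈ range (2 * c), (-1 : P) ^ i = 0 := by
    rw [neg_one_geom_sum, if_pos (even_two_mul c)]
  have h3 : ∀ i, (σ ^ (l * i)) (gauss l c r ζ lam * (1 - ζ)) =
      gauss l c r ζ lam * ((-1) ^ i - (-1) ^ i * ζ ^ (r ^ (l * i))) := by
    intro i
    rw [map_mul, S.sigma_pow_gauss hlam, map_sub, map_one, S.sigma_pow_zeta, S.neg_one_pow_mul]
    ring
  rw [traceElt, S.coe_trace_fixed]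
  simp_rw [h3]
  rw [← mul_sum, sum_sub_distrib, h2, period]
  ring

theorem sq_traceElt (S : CyclicSetup p l c r ζ σ) (hlam : lam * ((r : ℤ) - 1) ≡ 1 [ZMOD p]) :
    (traceElt l c r ζ σ lam : P) ^ 2 = (-1) ^ c * p * period l c r ζ ^ 2 := by
  rw [S.coe_traceElt hlam, neg_sq, mul_pow, S.gauss_sq hlam]

/-- The conjugate `σ ^ i y` of an element of the fixed field. -/
noncomputable def conj (i : ℕ) (y : fixed l σ) : fixed l σ := ⟨(σ ^ i) y, sigma_mem_fixed y.2 i⟩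

/-- Every power of ζ has trace -1, or p - 1 when the exponent vanishes modulo p. The contributions
-1 cancel against the alternating signs, so only an exponent 1 + r^(li+b) ≡ 0 counts, and by
`pow_eq_half_iff` that needs b = 0 and i = c. -/
theorem trace_sigma_pow_period (S : CyclicSetup p l c r ζ σ) {b : ℕ} (hb : b < l) :
    Algebra.trace ℚ P ((1 - ζ) * (σ ^ b) (period l c r ζ)) =
      if b = 0 then -((-1) ^ c * (p : ℚ)) else 0 := by
  have h2 : ∑ i ∈ range (2 * c), (-1 : ℚ) ^ i = 0 := by
    rw [neg_one_geom_sum, if_pos (even_two_mul c)]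
  have : Fact p.Prime := ⟨S.prime⟩
  have hr : (r : ZMod p) ≠ 0 := by
    intro h
    have := S.pow_half
    rw [h, zero_pow (Nat.mul_pos S.c_pos S.l_pos).ne'] at this
    exact one_ne_zero (neg_eq_zero.1 this.symm)
  have hq : ∀ (i a : ℕ), Algebra.trace ℚ P ((-1) ^ i * ζ ^ a) =
      (-1) ^ i * (if (a : ZMod p) = 0 then (p : ℚ) - 1 else -1) := by
    intro i a
    rw [← S.trace_zeta_pow a]
    have := (Algebra.trace ℚ P).map_smul ((-1 : ℚ) ^ i) (ζ ^ a)
    rw [Algebra.smul_def] at this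
    simpa using this
  have h3 : (1 - ζ) * (σ ^ b) (period l c r ζ) =
      (∑ i ∈ range (2 * c), (-1) ^ i * ζ ^ (r ^ (l * i + b))) -
      ∑ i ∈ range (2 * c), (-1) ^ i * ζ ^ (1 + r ^ (l * i + b)) := by
    rw [S.sigma_pow_period, sub_mul, one_mul, mul_sum]
    congr 1
    refine sum_congr rfl fun i _ => ?_
    ring
  have h4 : ∀ i ∈ range (2 * c), Algebra.trace ℚ P ((-1) ^ i * ζ ^ (r ^ (l * i + b))) =
      -(-1) ^ i := by
    intro i _
    rw [hq, if_neg (by push_cast; exact pow_ne_zero _ hr)]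
    ring
  have h5 : ∀ i ∈ range (2 * c), Algebra.trace ℚ P ((-1) ^ i * ζ ^ (1 + r ^ (l * i + b))) =
      (if i = c then (if b = 0 then (-1) ^ c * (p : ℚ) else 0) else 0) - (-1) ^ i := by
    intro i hi
    rw [hq]
    simp_rw [S.pow_eq_half_iff (mem_range.1 hi) hb]
    by_cases h6 : i = c <;> by_cases h7 : b = 0 <;> simp [h6, h7]
    ring
  rw [h3, map_sub, map_sum, map_sum, sum_congr rfl h4, sum_congr rfl h5, sum_sub_distrib,
    sum_neg_distrib, h2, sum_ite_eq']
  have := S.c_pos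
  rw [if_pos (by simp; omega)]
  split_ifs <;> simp

/-- Only one factor x is unfolded as a trace from ℚ(ζ), which makes the left side a trace of z
σ^b(x). There g occurs twice, and g² = ±p is rational, so the previous trace applies. -/
theorem trace_traceElt_mul (S : CyclicSetup p l c r ζ σ)
    (hlam : lam * ((r : ℤ) - 1) ≡ 1 [ZMOD p]) {b : ℕ} (hb : b < l) :
    Algebra.trace ℚ (fixed l σ) (traceElt l c r ζ σ lam * conj b (traceElt l c r ζ σ lam)) =
      if b = 0 then (p : ℚ) ^ 2 else 0 := by
  have h1 : traceElt l c r ζ σ lam * conj b (traceElt l c r ζ σ lam) =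
      Algebra.trace (fixed l σ) P
        ((conj b (traceElt l c r ζ σ lam)) • (gauss l c r ζ lam * (1 - ζ))) := by
    rw [map_smul, smul_eq_mul, mul_comm]
    rfl
  have h2 : (conj b (traceElt l c r ζ σ lam)) • (gauss l c r ζ lam * (1 - ζ)) =
      (-(-1) ^ b * (-1) ^ c * p : ℚ) • ((1 - ζ) * (σ ^ b) (period l c r ζ)) := by
    rw [Algebra.smul_def]
    change (σ ^ b) (traceElt l c r ζ σ lam : P) * _ = _
    rw [S.coe_traceElt hlam, map_neg, map_mul, S.sigma_pow_gauss hlam, Algebra.smul_def]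
    have := S.gauss_sq hlam
    simp only [map_mul, map_neg, map_pow, map_one, map_natCast]
    linear_combination (-(-1) ^ b * (σ ^ b) (period l c r ζ) * (1 - ζ)) * this
  rw [h1, Algebra.trace_trace, h2, map_smul, S.trace_sigma_pow_period hb]
  split_ifs with h
  · subst h
    have : ((-1 : ℚ) ^ c) * (-1) ^ c = 1 := by rw [← mul_pow]; simp
    simp only [smul_eq_mul]
    linear_combination (p : ℚ) ^ 2 * this
  · simp

end CyclicSetup

/-! ### Orthonormal expansions and elements equal up to a unit -/

/-- Expansion of a vector in an orthonormal basis of a scaled trace form. -/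
theorem eq_sum_trace_smul {F ι : Type*} [Field F] [NumberField F] [Fintype ι] [DecidableEq ι]
    (β : F) (B : ι → F) (hcard : Fintype.card ι = Module.finrank ℚ F)
    (hB : ∀ i j, Algebra.trace ℚ F (β * B i * B j) = if i = j then 1 else 0) (v : F) :
    v = ∑ i, (Algebra.trace ℚ F (β * v * B i)) • B i := by
  -- Pairing with a basis vector recovers a coordinate; this yields linear independence, hence
  -- spanning by dimension, and also the coefficients.
  have key : ∀ (g : ι → ℚ) (j : ι), Algebra.trace ℚ F (β * (∑ i, g i • B i) * B j) = g j := by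
    intro g j
    have h : β * (∑ i, g i • B i) * B j = ∑ i, g i • (β * B i * B j) := by
      rw [Finset.mul_sum, Finset.sum_mul]
      refine Finset.sum_congr rfl fun i _ => ?_
      rw [mul_smul_comm, smul_mul_assoc]
    rw [h, map_sum]
    simp_rw [map_smul, hB]
    simp
  have hli : LinearIndependent ℚ B := by
    rw [Fintype.linearIndependent_iff]
    intro g hg i
    rw [← key g i, hg]
    simp
  have hspan : v ∈ Submodule.span ℚ (Set.range B) := by
    rw [hli.span_eq_top_of_card_eq_finrank' hcard]
    trivial
  obtain ⟨g, rfl⟩ := (Submodule.mem_span_range_iff_exists_fun ℚ).1 hspan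
  simp_rw [key]

/-- `a` and `b` differ by a unit of the ring of all algebraic integers. -/
def UnitRatio {F : Type*} [Field F] (a b : F) : Prop :=
  IsIntegral ℤ (a / b) ∧ IsIntegral ℤ (b / a)

namespace UnitRatio

variable {F : Type*} [Field F] {a b d : F}

theorem symm (h : UnitRatio a b) : UnitRatio b a := ⟨h.2, h.1⟩

theorem trans (hb : b ≠ 0) (h : UnitRatio a b) (h' : UnitRatio b d) : UnitRatio a d := by
  constructor
  · rw [← div_mul_div_cancel₀ hb]; exact h.1.mul h'.1
  · rw [← div_mul_div_cancel₀ hb]; exact h'.2.mul h.2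

theorem pow (h : UnitRatio a b) (n : ℕ) : UnitRatio (a ^ n) (b ^ n) := by
  constructor
  · rw [← div_pow]; exact h.1.pow n
  · rw [← div_pow]; exact h.2.pow n

theorem of_pow {n : ℕ} (hn : 0 < n) (h : UnitRatio (a ^ n) (b ^ n)) : UnitRatio a b := by
  constructor
  · have := h.1; rw [← div_pow] at this; exact this.of_pow hn
  · have := h.2; rw [← div_pow] at this; exact this.of_pow hn

theorem prod {ι : Type*} (s : Finset ι) (f : ι → F) (h : ∀ i ∈ s, UnitRatio (f i) a) :
    UnitRatio (∏ i ∈ s, f i) (a ^ s.card) := by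
  constructor
  · rw [← Finset.prod_const, ← Finset.prod_div_distrib]
    exact IsIntegral.prod _ fun i hi => (h i hi).1
  · rw [← Finset.prod_const, ← Finset.prod_div_distrib]
    exact IsIntegral.prod _ fun i hi => (h i hi).2

end UnitRatio

/-! ### Divisibility by 1 - ζ and integrality of the trace form on the fixed field -/

namespace CyclicSetup

open Finset

variable {p l c r : ℕ} {P : Type*} [Field P] [NumberField P] {ζ : P} {σ : P ≃ₐ[ℚ] P} {lam : ℤ}

theorem isIntegral_sigma_pow_div {y : P} (hy0 : y ≠ 0) (hy : IsIntegral ℤ (σ y / y)) (i : ℕ) :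
    IsIntegral ℤ ((σ ^ i) y / y) := by
  induction i with
  | zero => simpa [hy0] using isIntegral_one
  | succ i ih =>
    have h := (isIntegral_sigma _ σ ih).mul hy
    rwa [map_div₀, div_mul_div_cancel₀ ((map_ne_zero σ).2 hy0), ← AlgEquiv.mul_apply,
      ← pow_succ'] at h

/-- Integrality of the inverse ratio comes from going round the cycle: y/σ^i(y) is the σ^i-image of
σ^((n-1)i)(y)/y, because σ^(ni) fixes y. -/
theorem unitRatio_sigma_pow {y : P} (hy0 : y ≠ 0) (hy : IsIntegral ℤ (σ y / y)) {n : ℕ}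
    (hn : 0 < n) (hσ : (σ ^ n) y = y) (i : ℕ) : UnitRatio ((σ ^ i) y) y := by
  refine ⟨isIntegral_sigma_pow_div hy0 hy i, ?_⟩
  have hk : ∀ k : ℕ, (σ ^ (n * k)) y = y := by
    intro k
    induction k with
    | zero => simp
    | succ k ih => rw [Nat.mul_succ, pow_add, AlgEquiv.mul_apply, hσ, ih]
  have h := isIntegral_sigma _ (σ ^ i) (isIntegral_sigma_pow_div hy0 hy ((n - 1) * i))
  rwa [map_div₀, ← AlgEquiv.mul_apply, ← pow_add,
    show i + (n - 1) * i = n * i by obtain ⟨m, rfl⟩ : ∃ m, n = m + 1 := ⟨n - 1, by omega⟩; simp; ring,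
    hk] at h

theorem p_sub_one_pos (S : CyclicSetup p l c r ζ σ) : 0 < p - 1 := by
  have := S.prime.two_le; omega

theorem isIntegral_one_sub (S : CyclicSetup p l c r ζ σ) : IsIntegral ℤ (1 - ζ) :=
  isIntegral_one.sub S.isIntegral_zeta

theorem neg_one_pow_mul_p_ne_zero (S : CyclicSetup p l c r ζ σ) : (-1 : P) ^ c * p ≠ 0 :=
  mul_ne_zero (pow_ne_zero _ (by simp)) (by exact_mod_cast S.prime.ne_zero)

theorem isIntegral_period (S : CyclicSetup p l c r ζ σ) : IsIntegral ℤ (period l c r ζ) := by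
  have h := S.isIntegral_period_div.mul S.isIntegral_one_sub
  rwa [div_mul_cancel₀ _ S.one_sub_ne_zero] at h

theorem isIntegral_period_sq_div (S : CyclicSetup p l c r ζ σ) :
    IsIntegral ℤ (period l c r ζ ^ 2 / (1 - ζ)) := by
  rw [sq, mul_div_assoc]
  exact S.isIntegral_period.mul S.isIntegral_period_div

variable [IsCyclotomicExtension {p} ℚ P]

theorem sigma_pow_sub_one (S : CyclicSetup p l c r ζ σ) : σ ^ (p - 1) = 1 := by
  rw [← S.orderOf_sigma, pow_orderOf_eq_one]

theorem unitRatio_one_sub (S : CyclicSetup p l c r ζ σ) (i : ℕ) :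
    UnitRatio ((σ ^ i) (1 - ζ)) (1 - ζ) := by
  refine unitRatio_sigma_pow S.one_sub_ne_zero ?_ S.p_sub_one_pos (by simp [S.sigma_pow_sub_one]) i
  simpa using S.isIntegral_sigma_pow_one_sub_div 1

theorem unitRatio_norm (S : CyclicSetup p l c r ζ σ) {y : P}
    (hy : ∀ i, UnitRatio ((σ ^ i) y) y) :
    UnitRatio (algebraMap ℚ P (Algebra.norm ℚ y)) (y ^ (p - 1)) := by
  have h := UnitRatio.prod (range (p - 1)) (fun i => (σ ^ i) y) (fun i _ => hy i)
  rwa [card_range, ← S.norm_eq] at h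

theorem unitRatio_p (S : CyclicSetup p l c r ζ σ) : UnitRatio (p : P) ((1 - ζ) ^ (p - 1)) := by
  have h := S.unitRatio_norm S.unitRatio_one_sub
  rwa [S.norm_one_sub, map_natCast] at h

theorem not_isIntegral_inv (S : CyclicSetup p l c r ζ σ) : ¬ IsIntegral ℤ ((1 - ζ)⁻¹) := by
  intro h
  have h2 := S.dvd_of_isIntegral (a := 1) (by simpa using h)
  exact S.prime.one_lt.not_ge (Nat.le_of_dvd one_pos (by exact_mod_cast h2))

theorem isIntegral_trace_fixed {V : fixed l σ} (hV : IsIntegral ℤ (V : P)) :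
    ∃ b : ℤ, Algebra.trace ℚ (fixed l σ) V = b := by
  have h : IsIntegral ℤ V :=
    (isIntegral_algebraMap_iff (FaithfulSMul.algebraMap_injective (fixed l σ) P)).1 hV
  exact exists_int_of_isIntegral (Algebra.isIntegral_trace h)

/-- The trace of a multiple of `1 - ζ` is divisible by `p`. -/
theorem dvd_trace_fixed (S : CyclicSetup p l c r ζ σ) {V : fixed l σ}
    (hV : IsIntegral ℤ ((V : P) / (1 - ζ))) :
    ∃ a : ℤ, Algebra.trace ℚ (fixed l σ) V = p * a := by
  have hV2 : IsIntegral ℤ (V : P) := by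
    have := hV.mul S.isIntegral_one_sub
    rwa [div_mul_cancel₀ _ S.one_sub_ne_zero] at this
  obtain ⟨b, hb⟩ := isIntegral_trace_fixed hV2
  have h := S.trace_fixed_eq V
  rw [hb, map_intCast] at h
  obtain ⟨a, rfl⟩ := S.dvd_of_isIntegral (a := b) (by
    rw [h, sum_div]
    exact IsIntegral.sum _ fun i _ => S.isIntegral_sigma_div hV i)
  exact ⟨a, by rw [hb]; push_cast; rfl⟩

/-- Integrality of the twisted trace form. -/
theorem trace_sq_traceElt_mul (S : CyclicSetup p l c r ζ σ)
    (hlam : lam * ((r : ℤ) - 1) ≡ 1 [ZMOD p]) {W : fixed l σ}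
    (hW : IsIntegral ℤ (period l c r ζ ^ 2 * (W : P) / (1 - ζ))) :
    ∃ a : ℤ, Algebra.trace ℚ (fixed l σ) (traceElt l c r ζ σ lam ^ 2 * W) = p ^ 2 * a := by
  have hp : (p : P) ≠ 0 := by exact_mod_cast S.prime.ne_zero
  -- One factor p is extracted from x² = (-1)^c p η²; the second comes from the trace of a multiple
  -- of 1 - ζ.
  obtain ⟨a, ha⟩ := S.dvd_trace_fixed
    (V := ((p : ℚ)⁻¹) • (traceElt l c r ζ σ lam ^ 2 * W)) (by
      have h : ((((p : ℚ)⁻¹) • (traceElt l c r ζ σ lam ^ 2 * W) : fixed l σ) : P) / (1 - ζ) =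
          (-1) ^ c * (period l c r ζ ^ 2 * (W : P) / (1 - ζ)) := by
        rw [Algebra.smul_def]
        push_cast
        rw [S.sq_traceElt hlam]
        field_simp
      rw [h]
      exact (isIntegral_one.neg.pow c).mul hW)
  refine ⟨a, ?_⟩
  have hp : (p : ℚ) ≠ 0 := by exact_mod_cast S.prime.ne_zero
  rw [map_smul, smul_eq_mul, inv_mul_eq_iff_eq_mul₀ hp] at ha
  rw [ha]
  ring

theorem trace_sq_traceElt_mul_of_isIntegral (S : CyclicSetup p l c r ζ σ)
    (hlam : lam * ((r : ℤ) - 1) ≡ 1 [ZMOD p]) {W : fixed l σ} (hW : IsIntegral ℤ W) :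
    ∃ a : ℤ, Algebra.trace ℚ (fixed l σ) (traceElt l c r ζ σ lam ^ 2 * W) = p ^ 2 * a := by
  refine S.trace_sq_traceElt_mul hlam ?_
  rw [mul_div_right_comm]
  exact S.isIntegral_period_sq_div.mul hW.algebraMap

theorem trace_conj (S : CyclicSetup p l c r ζ σ) (i : ℕ) (y : fixed l σ) :
    Algebra.trace ℚ (fixed l σ) (conj i y) = Algebra.trace ℚ (fixed l σ) y := by
  have h : Algebra.trace ℚ P ((σ ^ i) (y : P)) = Algebra.trace ℚ P (y : P) :=
    Algebra.trace_eq_of_algEquiv (σ ^ i) (y : P)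
  have h2 := S.trace_eq_mul_trace_fixed y
  have h3 := S.trace_eq_mul_trace_fixed (conj i y)
  rw [show ((conj i y : fixed l σ) : P) = (σ ^ i) y from rfl, h, h2] at h3
  have hc : (2 * c : ℚ) ≠ 0 := by have := S.c_pos; positivity
  exact (mul_left_cancel₀ hc h3).symm

/-- The conjugates of `traceElt` are orthogonal of square length `p ^ 2`. -/
theorem trace_conj_mul_conj (S : CyclicSetup p l c r ζ σ)
    (hlam : lam * ((r : ℤ) - 1) ≡ 1 [ZMOD p]) (i j : Fin l) :
    Algebra.trace ℚ (fixed l σ)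
      (conj i (traceElt l c r ζ σ lam) * conj j (traceElt l c r ζ σ lam)) =
      if i = j then (p : ℚ) ^ 2 else 0 := by
  wlog hij : i ≤ j generalizing i j
  · rw [mul_comm, this j i (le_of_not_ge hij)]
    simp_rw [eq_comm]
  have h : conj i (traceElt l c r ζ σ lam) * conj j (traceElt l c r ζ σ lam) =
      conj i (traceElt l c r ζ σ lam * conj (j - i : ℕ) (traceElt l c r ζ σ lam)) := by
    apply Subtype.ext
    change (σ ^ (i : ℕ)) _ * (σ ^ (j : ℕ)) _ = (σ ^ (i : ℕ)) (_ * (σ ^ (j - i : ℕ)) _)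
    rw [map_mul, ← AlgEquiv.mul_apply, ← pow_add, Nat.add_sub_cancel' hij]
  rw [h, S.trace_conj, S.trace_traceElt_mul hlam (by omega)]
  have : ((j : ℕ) - i = 0) ↔ i = j := by
    rw [Fin.ext_iff]; have : (i : ℕ) ≤ j := hij; omega
  simp_rw [this]

theorem traceElt_ne_zero (S : CyclicSetup p l c r ζ σ)
    (hlam : lam * ((r : ℤ) - 1) ≡ 1 [ZMOD p]) : traceElt l c r ζ σ lam ≠ 0 := by
  intro h
  have := S.trace_traceElt_mul hlam S.l_pos
  rw [h, zero_mul, map_zero, if_pos rfl] at this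
  exact pow_ne_zero 2 (by exact_mod_cast S.prime.ne_zero) this.symm

end CyclicSetup

/-! ### The norm of x -/

namespace CyclicSetup

open Finset

variable {p l c r : ℕ} {P : Type*} [Field P] [NumberField P] {ζ : P} {σ : P ≃ₐ[ℚ] P} {lam : ℤ}

variable (l c r ζ σ lam) in
/-- The square of the alternating period, as an element of the fixed field. -/
noncomputable def periodSq : fixed l σ :=
  ((-1) ^ c * (p : fixed l σ))⁻¹ * traceElt l c r ζ σ lam ^ 2

theorem traceElt_sq_eq (S : CyclicSetup p l c r ζ σ) :
    traceElt l c r ζ σ lam ^ 2 =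
      ((-1) ^ c * (p : fixed l σ)) * periodSq (p := p) l c r ζ σ lam := by
  rw [periodSq, mul_inv_cancel_left₀]
  refine mul_ne_zero (pow_ne_zero _ (by simp)) (by exact_mod_cast S.prime.ne_zero)

variable [IsCyclotomicExtension {p} ℚ P]

theorem unitRatio_traceElt (S : CyclicSetup p l c r ζ σ)
    (hlam : lam * ((r : ℤ) - 1) ≡ 1 [ZMOD p])
    (hu : IsIntegral ℤ (σ (traceElt l c r ζ σ lam : P) / (traceElt l c r ζ σ lam : P))) (i : ℕ) :
    UnitRatio ((σ ^ i) (traceElt l c r ζ σ lam : P)) (traceElt l c r ζ σ lam : P) :=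
  unitRatio_sigma_pow (by simpa using S.traceElt_ne_zero hlam) hu S.l_pos
    (mem_fixed_iff.1 (traceElt l c r ζ σ lam).2) i

/-- The square is used because σ^l negates the period itself, so only its square descends to the
fixed field. -/
theorem coe_periodSq (S : CyclicSetup p l c r ζ σ)
    (hlam : lam * ((r : ℤ) - 1) ≡ 1 [ZMOD p]) :
    (periodSq (p := p) l c r ζ σ lam : P) = period l c r ζ ^ 2 := by
  rw [periodSq]
  push_cast
  rw [S.sq_traceElt hlam, inv_mul_cancel_left₀ S.neg_one_pow_mul_p_ne_zero]

/-- Dividing Σ σ^i(x)² = Tr(x²) = p² by x² = ±pη² expresses p/η², up to sign, as a sum of squares of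
the integral ratios σ^i(x)/x. -/
theorem isIntegral_p_div_period_sq (S : CyclicSetup p l c r ζ σ)
    (hlam : lam * ((r : ℤ) - 1) ≡ 1 [ZMOD p])
    (hu : IsIntegral ℤ (σ (traceElt l c r ζ σ lam : P) / (traceElt l c r ζ σ lam : P))) :
    IsIntegral ℤ ((p : P) / period l c r ζ ^ 2) := by
  set x := (traceElt l c r ζ σ lam : P) with hx
  have hx0 : x ≠ 0 := by simpa [hx] using S.traceElt_ne_zero hlam
  have h1 := S.trace_fixed_eq (traceElt l c r ζ σ lam * traceElt l c r ζ σ lam)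
  have h2 := S.trace_traceElt_mul hlam S.l_pos
  rw [if_pos rfl, show conj 0 (traceElt l c r ζ σ lam) = traceElt l c r ζ σ lam from rfl] at h2
  rw [h2, map_pow, map_natCast] at h1
  have h3 : (p : P) / period l c r ζ ^ 2 = (-1) ^ c * ∑ i ∈ range l, ((σ ^ i) x / x) ^ 2 := by
    have hs := S.sq_traceElt hlam
    rw [← hx] at hs
    have hp : (p : P) ≠ 0 := by exact_mod_cast S.prime.ne_zero
    have he : period l c r ζ ^ 2 ≠ 0 := by
      intro h
      rw [h, mul_zero] at hs
      exact hx0 (pow_eq_zero_iff two_ne_zero |>.1 hs)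
    simp_rw [div_pow]
    rw [← sum_div, hs]
    have h4 : ∑ i ∈ range l, (σ ^ i) x ^ 2 = (p : P) ^ 2 := by
      rw [h1]
      refine sum_congr rfl fun i _ => ?_
      rw [← map_pow, sq]
      rfl
    rw [h4]
    field_simp
  rw [h3]
  exact (isIntegral_one.neg.pow c).mul
    (IsIntegral.sum _ fun i _ => ((S.unitRatio_traceElt hlam hu i).1).pow 2)

theorem isIntegral_fixed {y : fixed l σ} (hy : IsIntegral ℤ (y : P)) : IsIntegral ℤ y :=
  (isIntegral_algebraMap_iff (FaithfulSMul.algebraMap_injective (fixed l σ) P)).1 hy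

/-- The norm of the squared period is, up to sign, a power of `p`. -/
theorem exists_norm_periodSq (S : CyclicSetup p l c r ζ σ)
    (hlam : lam * ((r : ℤ) - 1) ≡ 1 [ZMOD p])
    (hu : IsIntegral ℤ (σ (traceElt l c r ζ σ lam : P) / (traceElt l c r ζ σ lam : P))) :
    ∃ f : ℕ, |Algebra.norm ℚ (periodSq (p := p) l c r ζ σ lam)| = (p : ℚ) ^ f := by
  set y := periodSq (p := p) l c r ζ σ lam with hy
  have hy1 : IsIntegral ℤ y := isIntegral_fixed (by
    rw [S.coe_periodSq hlam]; exact S.isIntegral_period.pow 2)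
  have hy2 : IsIntegral ℤ ((p : fixed l σ) / y) := isIntegral_fixed (by
    push_cast
    rw [S.coe_periodSq hlam]; exact S.isIntegral_p_div_period_sq hlam hu)
  have hy0 : y ≠ 0 := by
    intro h
    have := S.traceElt_sq_eq (lam := lam)
    rw [← hy, h, mul_zero] at this
    exact S.traceElt_ne_zero hlam (pow_eq_zero_iff two_ne_zero |>.1 this)
  obtain ⟨a, ha⟩ := exists_int_of_isIntegral (Algebra.isIntegral_norm ℚ hy1)
  obtain ⟨b, hb⟩ := exists_int_of_isIntegral (Algebra.isIntegral_norm ℚ hy2)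
  have hab : a * b = (p : ℤ) ^ l := by
    have h := Algebra.norm_algebraMap (S := fixed l σ) (p : ℚ)
    rw [show Module.finrank ℚ (fixed l σ) = l from S.finrank_fixed, map_natCast,
      ← mul_div_cancel₀ (p : fixed l σ) hy0, map_mul, ha, hb] at h
    exact_mod_cast h
  have hdvd : a.natAbs ∣ p ^ l := by
    rw [← Int.natCast_dvd_natCast, Int.natAbs_dvd]
    exact ⟨b, by rw [hab]; push_cast; rfl⟩
  obtain ⟨f, -, hf⟩ := (Nat.dvd_prime_pow S.prime).1 hdvd
  refine ⟨f, ?_⟩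
  rw [ha, ← Int.cast_abs, Int.abs_eq_natAbs, hf]
  push_cast
  rfl

/-- The conjugates of η² are associates, like those of x², so η² to the power p - 1 is associate to
its norm p^(2cf). Since p is associate to (1 - ζ)^(p-1), a root of exponent p - 1 can be taken,
integrality being stable under roots. -/
theorem unitRatio_period_sq (S : CyclicSetup p l c r ζ σ)
    (hlam : lam * ((r : ℤ) - 1) ≡ 1 [ZMOD p])
    (hu : IsIntegral ℤ (σ (traceElt l c r ζ σ lam : P) / (traceElt l c r ζ σ lam : P))) {f : ℕ}
    (hf : |Algebra.norm ℚ (periodSq (p := p) l c r ζ σ lam)| = (p : ℚ) ^ f) :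
    UnitRatio (period l c r ζ ^ 2) ((1 - ζ) ^ (2 * c * f)) := by
  have h1 : ∀ i, UnitRatio ((σ ^ i) (period l c r ζ ^ 2)) (period l c r ζ ^ 2) := by
    intro i
    have h := (S.unitRatio_traceElt hlam hu i).pow 2
    rw [← map_pow, S.sq_traceElt hlam, map_mul] at h
    have h0 := S.neg_one_pow_mul_p_ne_zero
    have h2 : (σ ^ i) ((-1 : P) ^ c * p) = (-1) ^ c * p := by
      rw [map_mul, map_pow, map_neg, map_one, map_natCast]
    rw [h2] at h
    unfold UnitRatio at h ⊢
    rwa [mul_div_mul_left _ _ h0, mul_div_mul_left _ _ h0] at h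
  have h2 := S.unitRatio_norm h1
  have h3 : Algebra.norm ℚ (period l c r ζ ^ 2) = (p : ℚ) ^ (2 * c * f) := by
    rw [← S.coe_periodSq hlam, S.norm_eq_norm_fixed_pow, pow_mul, ← sq_abs, hf]
    ring
  rw [h3, map_pow, map_natCast] at h2
  have h4 := S.unitRatio_p.pow (2 * c * f)
  have hp : (p : P) ≠ 0 := by exact_mod_cast S.prime.ne_zero
  have h5 := h2.symm.trans (pow_ne_zero _ hp) h4
  rw [← pow_mul (1 - ζ), mul_comm (p - 1), pow_mul] at h5
  exact h5.of_pow S.p_sub_one_pos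

variable (l c ζ σ) in
/-- The relative norm of `1 - ζ` down to the fixed field. -/
noncomputable def uniformizer : P := ∏ i ∈ range (2 * c), (σ ^ (l * i)) (1 - ζ)

theorem uniformizer_mem (S : CyclicSetup p l c r ζ σ) : uniformizer l c ζ σ ∈ fixed l σ := by
  rw [mem_fixed_iff, uniformizer, map_prod]
  have h : ∀ i, (σ ^ l) ((σ ^ (l * i)) (1 - ζ)) = (σ ^ (l * (i + 1))) (1 - ζ) := by
    intro i
    rw [← AlgEquiv.mul_apply, ← pow_add, mul_add, mul_one, add_comm]
  simp_rw [h]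
  have h1 := prod_range_succ (fun i => (σ ^ (l * i)) (1 - ζ)) (2 * c)
  rw [prod_range_succ'] at h1
  have h2 : σ ^ (l * (2 * c)) = 1 := by rw [mul_comm, ← S.sub_one, S.sigma_pow_sub_one]
  rw [h2, mul_zero, pow_zero] at h1
  exact mul_right_cancel₀ (by simpa using S.one_sub_ne_zero) h1

theorem unitRatio_uniformizer (S : CyclicSetup p l c r ζ σ) :
    UnitRatio (uniformizer l c ζ σ) ((1 - ζ) ^ (2 * c)) := by
  have h := UnitRatio.prod (range (2 * c)) (fun i => (σ ^ (l * i)) (1 - ζ))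
    (fun i _ => S.unitRatio_one_sub _)
  rwa [card_range] at h

/-- Every element of the fixed field expands in the conjugates of `traceElt`. -/
theorem eq_sum_conj (S : CyclicSetup p l c r ζ σ)
    (hlam : lam * ((r : ℤ) - 1) ≡ 1 [ZMOD p]) (v : fixed l σ) :
    v = ∑ i : Fin l, (((p : ℚ) ^ 2)⁻¹ * Algebra.trace ℚ (fixed l σ)
      (v * conj i (traceElt l c r ζ σ lam))) • conj i (traceElt l c r ζ σ lam) := by
  have hp : (p : ℚ) ^ 2 ≠ 0 := pow_ne_zero 2 (by exact_mod_cast S.prime.ne_zero)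
  have hβ : ∀ y : fixed l σ, Algebra.trace ℚ (fixed l σ) (algebraMap ℚ _ ((p : ℚ) ^ 2)⁻¹ * y) =
      ((p : ℚ) ^ 2)⁻¹ * Algebra.trace ℚ (fixed l σ) y := by
    intro y
    rw [← Algebra.smul_def, map_smul, smul_eq_mul]
  have h := eq_sum_trace_smul (algebraMap ℚ (fixed l σ) ((p : ℚ) ^ 2)⁻¹)
    (fun i : Fin l => conj i (traceElt l c r ζ σ lam))
    (by rw [Fintype.card_fin]; exact S.finrank_fixed.symm) (fun i j => by
      rw [mul_assoc, hβ, S.trace_conj_mul_conj hlam]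
      split_ifs
      · exact inv_mul_cancel₀ hp
      · exact mul_zero _) v
  simp_rw [mul_assoc, hβ] at h
  exact h

/-- The norm is p^f. If f = 0, η² would be a unit although 1 - ζ divides it. If f ≥ 2, η² stays
divisible by 1 - ζ after division by the relative norm of 1 - ζ; the trace form is then integral on
too large a set, which contradicts that the orthogonal conjugates of x span only integral multiples
of x. -/
theorem norm_periodSq (S : CyclicSetup p l c r ζ σ)
    (hlam : lam * ((r : ℤ) - 1) ≡ 1 [ZMOD p])
    (hu : IsIntegral ℤ (σ (traceElt l c r ζ σ lam : P) / (traceElt l c r ζ σ lam : P))) :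
    |Algebra.norm ℚ (periodSq (p := p) l c r ζ σ lam)| = p := by
  obtain ⟨f, hf⟩ := S.exists_norm_periodSq hlam hu
  have hy := S.unitRatio_period_sq hlam hu hf
  have hc := S.c_pos
  have hz := S.one_sub_ne_zero
  rcases Nat.lt_trichotomy f 1 with h | h | h
  · exfalso
    obtain rfl : f = 0 := by omega
    have h1 := hy.2.mul S.isIntegral_period_sq_div
    have h0 : period l c r ζ ^ 2 ≠ 0 := by
      intro h0
      have hx := S.sq_traceElt hlam
      rw [h0, mul_zero] at hx
      have := S.traceElt_ne_zero hlam
      exact this (by simpa using hx)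
    rw [div_mul_div_cancel₀ h0] at h1
    exact S.not_isIntegral_inv (by simpa using h1)
  · rw [hf, h, pow_one]
  · exfalso
    set g : fixed l σ := ⟨uniformizer l c ζ σ, S.uniformizer_mem⟩ with hg
    have hgc : (g : P) = uniformizer l c ζ σ := rfl
    set x := traceElt l c r ζ σ lam with hx
    have hx0 : x ≠ 0 := S.traceElt_ne_zero hlam
    have hG := S.unitRatio_uniformizer
    -- With f ≥ 2 and c ≥ 1 the exponent 2cf is at least 2c + 1: 2c factors pay for g and one more
    -- for 1 - ζ.
    have hgp : IsIntegral ℤ (period l c r ζ ^ 2 * ((g : P))⁻¹ / (1 - ζ)) := by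
      have h1 := (hy.1.mul hG.2).mul (S.isIntegral_one_sub.pow (2 * c * f - (2 * c + 1)))
      have h2 : 2 * c + 1 ≤ 2 * c * f := by nlinarith
      have h3 : (1 - ζ) ^ (2 * c * f) =
          (1 - ζ) ^ (2 * c * f - (2 * c + 1)) * ((1 - ζ) ^ (2 * c) * (1 - ζ)) := by
        rw [← pow_succ, ← pow_add, Nat.sub_add_cancel h2]
      rw [h3] at h1
      refine (congrArg (IsIntegral ℤ) ?_).mp h1
      rw [hgc]
      field_simp
    -- The coordinates of x/g in the orthogonal system are p⁻² Tr(x² · g⁻¹ · σ^i(x)/x), which the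
    -- strong form of integrality covers even though g⁻¹ is not integral.
    have h1 : ∀ i : Fin l, ∃ a : ℤ, ((p : ℚ) ^ 2)⁻¹ *
        Algebra.trace ℚ (fixed l σ) (x * g⁻¹ * conj i x) = a := by
      intro i
      obtain ⟨a, ha⟩ := S.trace_sq_traceElt_mul hlam (W := g⁻¹ * (conj i x / x)) (by
        have h2 := hgp.mul (S.unitRatio_traceElt hlam hu i).1
        refine (congrArg (IsIntegral ℤ) ?_).mp h2
        change _ = period l c r ζ ^ 2 * ((g : P)⁻¹ * ((σ ^ (i : ℕ)) (x : P) / (x : P))) / (1 - ζ)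
        ring)
      refine ⟨a, ?_⟩
      have hp : (p : ℚ) ^ 2 ≠ 0 := pow_ne_zero 2 (by exact_mod_cast S.prime.ne_zero)
      rw [inv_mul_eq_iff_eq_mul₀ hp, ← ha]
      congr 1
      rw [← hx]
      field_simp
    choose a ha using h1
    have h2 := S.eq_sum_conj hlam (x * g⁻¹)
    simp_rw [← hx, ha] at h2
    have h3 : ((g : P))⁻¹ = ∑ i : Fin l, (a i : P) * ((σ ^ (i : ℕ)) (x : P) / (x : P)) := by
      have h4 := congrArg (fun v : fixed l σ => (v : P)) h2
      have hx1 : (x : P) ≠ 0 := by simpa using hx0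
      have h5 : ((x : P)) * ((g : P))⁻¹ = ∑ i : Fin l, (a i : P) * (σ ^ (i : ℕ)) (x : P) := by
        refine h4.trans ?_
        simp only [AddSubmonoidClass.coe_finsetSum, Algebra.smul_def]
        refine sum_congr rfl fun i _ => ?_
        simp [conj]
      rw [← mul_right_inj' hx1, h5, mul_sum]
      refine sum_congr rfl fun i _ => ?_
      field_simp
    have h4 : IsIntegral ℤ ((g : P))⁻¹ := by
      rw [h3]
      exact IsIntegral.sum _ fun i _ =>
        (isIntegral_intCast _).mul (S.unitRatio_traceElt hlam hu i).1
    -- g⁻¹ · g/(1 - ζ)^(2c) · (1 - ζ)^(2c-1) is (1 - ζ)⁻¹, which is not integral.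
    have h5 := (h4.mul hG.1).mul (S.isIntegral_one_sub.pow (2 * c - 1))
    have hg0 : (g : P) ≠ 0 := by
      rw [hgc, uniformizer, prod_ne_zero_iff]
      intro i _
      exact (map_ne_zero _).2 hz
    refine S.not_isIntegral_inv ?_
    refine (congrArg (IsIntegral ℤ) ?_).mp h5
    have h6 : (1 - ζ) ^ (2 * c) = (1 - ζ) ^ (2 * c - 1) * (1 - ζ) := by
      rw [← pow_succ]; congr 1; omega
    rw [← hgc, h6]
    field_simp

/-- The norm of `traceElt`. -/
theorem norm_traceElt_sq (S : CyclicSetup p l c r ζ σ)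
    (hlam : lam * ((r : ℤ) - 1) ≡ 1 [ZMOD p])
    (hu : IsIntegral ℤ (σ (traceElt l c r ζ σ lam : P) / (traceElt l c r ζ σ lam : P))) :
    Algebra.norm ℚ (traceElt l c r ζ σ lam) ^ 2 = (p : ℚ) ^ (l + 1) := by
  have h2 : Algebra.norm ℚ ((-1) ^ c * (p : fixed l σ)) = ((-1) ^ c * (p : ℚ)) ^ l := by
    have h := Algebra.norm_algebraMap (S := fixed l σ) ((-1) ^ c * (p : ℚ))
    rw [show Module.finrank ℚ (fixed l σ) = l from S.finrank_fixed] at h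
    rw [← h]
    simp
  rw [← abs_of_nonneg (sq_nonneg (Algebra.norm ℚ (traceElt l c r ζ σ lam))), ← map_pow,
    S.traceElt_sq_eq, map_mul, h2, abs_mul, S.norm_periodSq hlam hu, abs_pow, abs_mul, abs_pow,
    abs_neg, abs_one, one_pow, one_mul, Nat.abs_cast, pow_succ]

end CyclicSetup

/-! ### The maximal real subfield of the 2^m-th cyclotomic field -/

/-- `ω` is a primitive `2 ^ m`-th root of unity in the cyclotomic field `C`, and `L` is the
subfield generated by `θ = ω + ω⁻¹`. -/
structure TwoPowSetup (m : ℕ) {C L : Type*} [Field C] [Field L] [NumberField L] [Algebra L C]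
    (ω : C) (θ : L) : Prop where
  le : 3 ≤ m
  prim : IsPrimitiveRoot ω (2 ^ m)
  map_theta : algebraMap L C θ = ω + ω⁻¹
  adjoin_theta : ℚ⟮θ⟯ = ⊤

/-- The elements `ω ^ (-j) + ⋯ + ω ^ j` as polynomials in `θ = ω + ω⁻¹`. -/
def oddSum {L : Type*} [CommRing L] (θ : L) : ℕ → L
  | 0 => 1
  | 1 => 1 + θ
  | n + 2 => θ * oddSum θ (n + 1) - oddSum θ n

theorem isIntegral_oddSum {L : Type*} [CommRing L] {θ : L} (hθ : IsIntegral ℤ θ) :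
    ∀ n, IsIntegral ℤ (oddSum θ n)
  | 0 => isIntegral_one
  | 1 => isIntegral_one.add hθ
  | n + 2 => (hθ.mul (isIntegral_oddSum hθ (n + 1))).sub (isIntegral_oddSum hθ n)

namespace TwoPowSetup

variable {m : ℕ} {C L : Type*} [Field C] [Field L] [NumberField L] [Algebra L C] {ω : C} {θ : L}

theorem ne_zero (S : TwoPowSetup m ω θ) : ω ≠ 0 := S.prim.ne_zero (by positivity)

theorem two_pow_eq (S : TwoPowSetup m ω θ) : 2 ^ m = 2 * (2 * 2 ^ (m - 2)) := by
  have := S.le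
  rw [← pow_succ', ← pow_succ']
  congr 1; omega

theorem pow_half (S : TwoPowSetup m ω θ) : ω ^ (2 * 2 ^ (m - 2)) = -1 := by
  have h : (ω ^ (2 * 2 ^ (m - 2))) ^ 2 = 1 := by
    rw [← pow_mul, mul_comm, ← S.two_pow_eq, S.prim.pow_eq_one]
  rcases _root_.sq_eq_one_iff.1 h with h | h
  · have h2 := Nat.le_of_dvd (by positivity) (S.prim.dvd_of_pow_eq_one _ h)
    rw [S.two_pow_eq] at h2
    have : 0 < 2 ^ (m - 2) := by positivity
    omega
  · exact h

/-- The geometric sum formula with denominators cleared, which avoids a square root of ω; the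
recursion is that of Chebyshev polynomials. -/
theorem map_oddSum (S : TwoPowSetup m ω θ) :
    ∀ n, algebraMap L C (oddSum θ n) * (1 - ω) * ω ^ n = 1 - ω ^ (2 * n + 1)
  | 0 => by simp [oddSum]
  | 1 => by
    have := S.ne_zero
    simp only [oddSum, map_add, map_one, S.map_theta]
    field_simp
    ring
  | n + 2 => by
    have h1 := S.map_oddSum (n + 1)
    have h2 := S.map_oddSum n
    have h0 := S.ne_zero
    simp only [oddSum, map_sub, map_mul, S.map_theta]
    have h3 : (ω + ω⁻¹) * ω = ω ^ 2 + 1 := by field_simp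
    linear_combination (ω ^ 2 + 1) * h1 - ω ^ 2 * h2 +
      algebraMap L C (oddSum θ (n + 1)) * (1 - ω) * ω ^ (n + 1) * h3

theorem map_two_sub (S : TwoPowSetup m ω θ) :
    algebraMap L C (2 - θ) = (ω - 1) * (ω⁻¹ - 1) := by
  have h0 := S.ne_zero
  rw [map_sub, S.map_theta, map_ofNat]
  field_simp
  ring

theorem one_sub_ne_zero (S : TwoPowSetup m ω θ) : 1 - ω ≠ 0 :=
  sub_ne_zero.2 (S.prim.ne_one (Nat.one_lt_two_pow (by have := S.le; omega))).symm

theorem two_sub_ne_zero (S : TwoPowSetup m ω θ) : 2 - θ ≠ 0 := by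
  intro h
  have h2 := S.map_two_sub
  rw [h, map_zero] at h2
  have h3 := S.one_sub_ne_zero
  rcases mul_eq_zero.1 h2.symm with h5 | h5
  · exact h3 (by linear_combination -h5)
  · rw [sub_eq_zero, inv_eq_one] at h5
    exact h3 (by rw [h5, sub_self])

/-- The factor 2 - θ = -(1 - ω)² ω⁻¹ cancels the denominators of the two geometric sums, leaving
four powers of ω whose traces are easy. -/
theorem map_two_sub_mul (S : TwoPowSetup m ω θ) {i j : ℕ} (hij : i ≤ j) :
    algebraMap L C ((2 - θ) * oddSum θ i * oddSum θ j) =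
      ω ^ (j - i) + ω⁻¹ ^ (j - i) - (ω ^ (i + j + 1) + ω⁻¹ ^ (i + j + 1)) := by
  have h0 := S.ne_zero
  obtain ⟨d, rfl⟩ := Nat.exists_eq_add_of_le hij
  rw [map_mul, map_mul, S.map_two_sub, Nat.add_sub_cancel_left]
  have h1 := S.map_oddSum i
  have h2 := S.map_oddSum (i + d)
  rw [← eq_div_iff (pow_ne_zero _ h0)] at h1 h2
  have h3 : (ω - 1) * (ω⁻¹ - 1) = -(1 - ω) * (1 - ω) * ω⁻¹ := by
    field_simp
    ring
  rw [h3]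
  calc _ = -(algebraMap L C (oddSum θ i) * (1 - ω)) *
        (algebraMap L C (oddSum θ (i + d)) * (1 - ω)) * ω⁻¹ := by ring
    _ = _ := by
      rw [h1, h2, inv_pow, inv_pow]
      field_simp
      ring

theorem algHom_ext_theta (S : TwoPowSetup m ω θ) {A : Type*} [Semiring A] [Algebra ℚ A]
    {f g : L →ₐ[ℚ] A} (h : f θ = g θ) : f = g := by
  refine AlgHom.ext_of_adjoin_eq_top (s := {θ}) ?_ ?_
  · have h := IntermediateField.adjoin_simple_toSubalgebra_of_isAlgebraic
      (Algebra.IsAlgebraic.isAlgebraic (R := ℚ) θ)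
    rw [← h, S.adjoin_theta, IntermediateField.top_toSubalgebra]
  · rintro _ rfl
    exact h

variable [NumberField C]

theorem conj_fixes (S : TwoPowSetup m ω θ) {τ : C ≃ₐ[ℚ] C} (hτ : τ ω = ω⁻¹) (y : L) :
    τ (algebraMap L C y) = algebraMap L C y := by
  have h : (τ.toAlgHom.comp (IsScalarTower.toAlgHom ℚ L C)) = IsScalarTower.toAlgHom ℚ L C := by
    apply S.algHom_ext_theta
    change τ (algebraMap L C θ) = algebraMap L C θ
    rw [S.map_theta, map_add, map_inv₀, hτ, inv_inv, add_comm]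
  exact DFunLike.congr_fun h y

variable [IsCyclotomicExtension {2 ^ m} ℚ C]

theorem finrank_top (S : TwoPowSetup m ω θ) : Module.finrank ℚ C = 2 * 2 ^ (m - 2) := by
  have := S.le
  rw [IsCyclotomicExtension.finrank C (Polynomial.cyclotomic.irreducible_rat (n := 2 ^ m)
    (by positivity)), Nat.totient_prime_pow Nat.prime_two (by omega), ← pow_succ']
  simp only [Nat.reduceSub, mul_one]
  congr 1; omega

theorem exists_aut (S : TwoPowSetup m ω θ) {u : ℕ} (hu : Odd u) :
    ∃ τ : C ≃ₐ[ℚ] C, τ ω = ω ^ u := by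
  have hc : u.Coprime (2 ^ m) := (Nat.coprime_two_right.2 hu).pow_right m
  refine ⟨(IsCyclotomicExtension.Rat.galEquivZMod (2 ^ m) C).symm (ZMod.unitOfCoprime u hc), ?_⟩
  rw [IsCyclotomicExtension.Rat.galEquivZMod_apply_of_pow_eq (2 ^ m) C _ S.prim.pow_eq_one]
  simp only [MulEquiv.apply_symm_apply, ZMod.coe_unitOfCoprime, ZMod.val_natCast]
  conv_rhs => rw [← Nat.mod_add_div u (2 ^ m), pow_add, pow_mul, S.prim.pow_eq_one, one_pow, mul_one]

theorem exists_conj (S : TwoPowSetup m ω θ) : ∃ τ : C ≃ₐ[ℚ] C, τ ω = ω⁻¹ := by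
  have hm : 2 ^ m = 2 ^ m - 1 + 1 := by have : 0 < 2 ^ m := by positivity
                                        omega
  obtain ⟨τ, h⟩ := S.exists_aut (u := 2 ^ m - 1) (by
    rw [S.two_pow_eq]
    have : 0 < 2 ^ (m - 2) := by positivity
    exact ⟨2 * 2 ^ (m - 2) - 1, by omega⟩)
  refine ⟨τ, ?_⟩
  rw [h]
  apply eq_inv_of_mul_eq_one_left
  rw [← pow_succ, ← hm, S.prim.pow_eq_one]

/-- Some automorphism negates ω^j. With j = 2^e j', j' odd and e < m - 1, raising ω to the power 1 +
2^(m-1-e) multiplies ω^j by ω^(2^(m-1) j') = -1. -/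
theorem trace_pow_eq_zero (S : TwoPowSetup m ω θ) {j : ℕ} (hj : ¬ 2 * 2 ^ (m - 2) ∣ j) :
    Algebra.trace ℚ C (ω ^ j) = 0 := by
  have hj0 : j ≠ 0 := by rintro rfl; exact hj (dvd_zero _)
  obtain ⟨e, j', hodd, rfl⟩ := Nat.exists_eq_two_pow_mul_odd hj0
  have hm := S.le
  have he : e < m - 1 := by
    by_contra h
    refine hj ((Dvd.dvd.mul_right ?_ j'))
    rw [← pow_succ']
    exact pow_dvd_pow 2 (by omega)
  obtain ⟨τ, hτ⟩ := S.exists_aut (u := 1 + 2 ^ (m - 1 - e)) (by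
    refine Even.one_add ?_
    exact (Nat.even_pow.2 ⟨even_two, by omega⟩))
  have h1 : τ (ω ^ (2 ^ e * j')) = -ω ^ (2 ^ e * j') := by
    have h2 : (1 + 2 ^ (m - 1 - e)) * (2 ^ e * j') = 2 ^ e * j' + 2 * 2 ^ (m - 2) * j' := by
      have : 2 * 2 ^ (m - 2) = 2 ^ (m - 1 - e) * 2 ^ e := by
        rw [← pow_succ', ← pow_add]; congr 1; omega
      rw [this]; ring
    rw [map_pow, hτ, ← pow_mul, h2, pow_add, pow_mul ω (2 * 2 ^ (m - 2)), S.pow_half,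
      hodd.neg_one_pow]
    ring
  have h2 := Algebra.trace_eq_of_algEquiv τ (ω ^ (2 ^ e * j'))
  rw [h1, map_neg] at h2
  linarith

theorem exists_trace_pow (S : TwoPowSetup m ω θ) (j : ℕ) :
    ∃ a : ℤ, Algebra.trace ℚ C (ω ^ j) = 2 * 2 ^ (m - 2) * a := by
  by_cases hj : 2 * 2 ^ (m - 2) ∣ j
  · obtain ⟨i, rfl⟩ := hj
    refine ⟨(-1) ^ i, ?_⟩
    have h := Algebra.trace_algebraMap (R := ℚ) (S := C) ((-1) ^ i)
    rw [map_pow, map_neg, map_one, S.finrank_top] at h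
    rw [pow_mul, S.pow_half, h]
    push_cast
    simp
  · exact ⟨0, by rw [S.trace_pow_eq_zero hj]; simp⟩

/-- The trace of an integer of the `2 ^ m`-th cyclotomic field is divisible by its degree. -/
theorem exists_trace (S : TwoPowSetup m ω θ) {y : C} (hy : IsIntegral ℤ y) :
    ∃ a : ℤ, Algebra.trace ℚ C y = 2 * 2 ^ (m - 2) * a := by
  have : Fact (Nat.Prime 2) := ⟨Nat.prime_two⟩
  -- The ring of integers is ℤ[ω], so the claim reduces to powers of ω.
  have h := IsCyclotomicExtension.Rat.isIntegralClosure_adjoin_singleton_of_prime_pow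
    (p := 2) (k := m) S.prim
  obtain ⟨⟨z, hz⟩, rfl⟩ := h.isIntegral_iff.1 hy
  rw [Algebra.adjoin_singleton_eq_range_aeval] at hz
  obtain ⟨f, rfl⟩ := hz
  choose a ha using S.exists_trace_pow
  refine ⟨∑ i ∈ Finset.range (f.natDegree + 1), f.coeff i * a i, ?_⟩
  change Algebra.trace ℚ C (Polynomial.aeval ω f) = _
  rw [Polynomial.aeval_eq_sum_range, map_sum]
  push_cast
  rw [Finset.mul_sum]
  refine Finset.sum_congr rfl fun i _ => ?_
  rw [map_zsmul, ha, zsmul_eq_mul]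
  ring

theorem finrank_two (S : TwoPowSetup m ω θ) : Module.finrank L C = 2 := by
  obtain ⟨τ, hτ⟩ := S.exists_conj
  have hω : IsIntegral L ω := (S.prim.isIntegral (by positivity)).tower_top
  have htop : IntermediateField.adjoin L {ω} = ⊤ := by
    have h := IsCyclotomicExtension.adjoin_primitive_root_eq_top (A := ℚ) S.prim
    have h2 : Algebra.adjoin ℚ {ω} ≤
        ((IntermediateField.adjoin L {ω}).toSubalgebra.restrictScalars ℚ) :=
      Algebra.adjoin_le (by simp)
    rw [h] at h2
    exact top_le_iff.1 fun y _ => h2 (Algebra.mem_top (x := y))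
  have h1 := IntermediateField.adjoin.finrank hω
  rw [htop, IntermediateField.finrank_top'] at h1
  rw [h1]
  apply le_antisymm
  · have hm : (Polynomial.X ^ 2 - Polynomial.C θ * Polynomial.X + 1 : Polynomial L).Monic := by
      monicity!
    have hd : (Polynomial.X ^ 2 - Polynomial.C θ * Polynomial.X + 1 : Polynomial L).natDegree = 2 := by
      compute_degree!
    rw [← hd]
    refine Polynomial.natDegree_le_of_dvd (minpoly.dvd L ω ?_) hm.ne_zero
    have := S.ne_zero
    simp [S.map_theta]
    field_simp
    ring
  -- If ω lay in the subfield, conjugation would fix it, giving ω² = 1.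
  · rw [minpoly.two_le_natDegree_iff hω]
    rintro ⟨y, rfl⟩
    have h := S.conj_fixes hτ y
    rw [hτ] at h
    have h2 : (algebraMap L C y) ^ 2 = 1 := by
      rw [sq]; nth_rewrite 1 [← h]
      exact inv_mul_cancel₀ S.ne_zero
    have h3 := Nat.le_of_dvd two_pos (S.prim.dvd_of_pow_eq_one _ h2)
    rw [S.two_pow_eq] at h3
    have : 0 < 2 ^ (m - 2) := by positivity
    omega

theorem finrank_eq (S : TwoPowSetup m ω θ) : Module.finrank ℚ L = 2 ^ (m - 2) := by
  have h := Module.finrank_mul_finrank ℚ L C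
  rw [S.finrank_two, S.finrank_top] at h
  omega

theorem trace_algebraMap (S : TwoPowSetup m ω θ) (y : L) :
    Algebra.trace ℚ C (algebraMap L C y) = 2 * Algebra.trace ℚ L y := by
  rw [← Algebra.trace_trace (S := L), Algebra.trace_algebraMap, S.finrank_two, map_nsmul]
  simp

theorem norm_algebraMap (S : TwoPowSetup m ω θ) (y : L) :
    Algebra.norm ℚ (algebraMap L C y) = Algebra.norm ℚ y ^ 2 := by
  rw [← Algebra.norm_norm (S := L), Algebra.norm_algebraMap, S.finrank_two, map_pow]

theorem trace_inv_pow (S : TwoPowSetup m ω θ) (j : ℕ) :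
    Algebra.trace ℚ C (ω⁻¹ ^ j) = Algebra.trace ℚ C (ω ^ j) := by
  obtain ⟨τ, hτ⟩ := S.exists_conj
  rw [← hτ, ← map_pow]
  exact Algebra.trace_eq_of_algEquiv τ _

/-- The elements `oddSum θ j` are orthogonal for the trace form scaled by `2 - θ`. -/
theorem trace_oddSum (S : TwoPowSetup m ω θ) (i j : Fin (2 ^ (m - 2))) :
    Algebra.trace ℚ L ((2 - θ) * oddSum θ i * oddSum θ j) =
      if i = j then 2 * 2 ^ (m - 2) else 0 := by
  wlog hij : i ≤ j generalizing i j
  · rw [mul_right_comm, this j i (le_of_not_ge hij)]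
    simp_rw [eq_comm]
  have hij' : (i : ℕ) ≤ j := hij
  have h := S.trace_algebraMap ((2 - θ) * oddSum θ i * oddSum θ j)
  -- Here 0 < i + j + 1 < 2k, so that power has trace zero; only ω^(j-i) with i = j can contribute.
  rw [S.map_two_sub_mul hij', map_sub, map_add, map_add, S.trace_inv_pow, S.trace_inv_pow,
    S.trace_pow_eq_zero (j := i + j + 1) (fun hd => by
      have := Nat.le_of_dvd (by omega) hd
      omega)] at h
  split_ifs with h1
  · subst h1
    have h2 := Algebra.trace_algebraMap (R := ℚ) (S := C) 1
    rw [map_one, S.finrank_top] at h2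
    rw [Nat.sub_self, pow_zero, h2] at h
    simp at h
    linarith
  · rw [S.trace_pow_eq_zero (fun hd => by
      have h3 : (i : ℕ) ≠ j := fun h => h1 (Fin.ext h)
      have := Nat.le_of_dvd (by omega) hd
      omega)] at h
    linarith

/-- `(2 - θ) / 2 ^ (m - 1)` lies in the inverse different. -/
theorem exists_trace_two_sub_mul (S : TwoPowSetup m ω θ) {W : L} (hW : IsIntegral ℤ W) :
    ∃ a : ℤ, Algebra.trace ℚ L ((2 - θ) * W) = 2 * 2 ^ (m - 2) * a := by
  obtain ⟨τ, hτ⟩ := S.exists_conj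
  have hω : IsIntegral ℤ ω := S.prim.isIntegral (by positivity)
  obtain ⟨a, ha⟩ := S.exists_trace (y := algebraMap L C W) hW.algebraMap
  obtain ⟨b, hb⟩ := S.exists_trace (y := ω * algebraMap L C W) (hω.mul hW.algebraMap)
  -- Conjugation fixes W and inverts ω, so the terms with ω and ω⁻¹ have equal traces; this equality
  -- absorbs the factor 2 = [C : L].
  have hb' : Algebra.trace ℚ C (ω⁻¹ * algebraMap L C W) = 2 * 2 ^ (m - 2) * b := by
    rw [← hb, ← hτ]
    nth_rewrite 1 [← S.conj_fixes hτ W]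
    rw [← map_mul]
    exact Algebra.trace_eq_of_algEquiv τ _
  have h := S.trace_algebraMap ((2 - θ) * W)
  have h2 : algebraMap L C ((2 - θ) * W) =
      (2 : ℚ) • algebraMap L C W - ω * algebraMap L C W - ω⁻¹ * algebraMap L C W := by
    rw [map_mul, map_sub, S.map_theta, map_ofNat, Algebra.smul_def, map_ofNat]
    ring
  rw [h2, map_sub, map_sub, map_smul, ha, hb, hb'] at h
  refine ⟨a - b, ?_⟩
  push_cast
  simp only [smul_eq_mul] at h
  linarith

/-- Both ω - 1 and ω⁻¹ - 1 have norm 2 in the quadratic extension C. Only the square is obtained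
this way; the sign is settled later by total positivity. -/
theorem norm_two_sub_sq (S : TwoPowSetup m ω θ) : Algebra.norm ℚ (2 - θ) ^ 2 = 4 := by
  have hm : 2 ≤ m := by have := S.le; omega
  have hirr : Irreducible (Polynomial.cyclotomic (2 ^ m) ℚ) :=
    Polynomial.cyclotomic.irreducible_rat (by positivity)
  rw [← S.norm_algebraMap (C := C), S.map_two_sub, map_mul, S.prim.norm_sub_one_two hm hirr,
    S.prim.inv.norm_sub_one_two hm hirr]
  norm_num

end TwoPowSetup

/-! ### The compositum: an orthonormal basis of a principal ideal -/

namespace MixedLattice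

open Algebra

/-- Orthogonal systems of two subfields `K` and `L` of `E`, which are linearly disjoint and
generate `E`, together with the integrality properties of their twisted trace forms. -/
structure CompositumSetup (p k l : ℕ) {K L E : Type*} [Field K] [NumberField K] [Field L]
    [NumberField L] [Field E] [NumberField E] [Algebra K E] [Algebra L E]
    (x₀ : K) (x : Fin l → K) (θ : L) (s : Fin k → L) : Prop where
  odd : Odd p
  k_two_pow : ∃ a, k = 2 ^ a
  finrank_eq : Module.finrank ℚ E = k * l
  trace_eq : ∀ b : L, trace K E (algebraMap L E b) = algebraMap ℚ K (trace ℚ L b)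
  norm_K : ∀ a : K, norm ℚ (algebraMap K E a) = norm ℚ a ^ k
  norm_L : ∀ b : L, norm ℚ (algebraMap L E b) = norm ℚ b ^ l
  ne_zero : x₀ ≠ 0
  isIntegral_x : IsIntegral ℤ x₀
  isIntegral_div : ∀ i, IsIntegral ℤ (x i / x₀)
  trace_x : ∀ i j, trace ℚ K (x i * x j) = if i = j then (p : ℚ) ^ 2 else 0
  trace_sq : ∀ W : K, IsIntegral ℤ W → ∃ a : ℤ, trace ℚ K (x₀ ^ 2 * W) = p ^ 2 * a
  isIntegral_s : ∀ j, IsIntegral ℤ (s j)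
  isIntegral_theta : IsIntegral ℤ θ
  trace_s : ∀ i j, trace ℚ L ((2 - θ) * s i * s j) = if i = j then 2 * (k : ℚ) else 0
  trace_two_sub : ∀ W : L, IsIntegral ℤ W → ∃ a : ℤ, trace ℚ L ((2 - θ) * W) = 2 * k * a

namespace CompositumSetup

section Twist

variable {p k : ℕ} {L E : Type*} [Field L] [Field E] [NumberField E] [Algebra L E] {θ : L}

variable (E p k θ) in
/-- The twisting element `p⁻² (2 - θ) / (2k)`. -/
noncomputable def twist : E :=
  algebraMap ℚ E (((p : ℚ) ^ 2)⁻¹ * (2 * (k : ℚ))⁻¹) * algebraMap L E (2 - θ)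

theorem trace_twist_mul (y : E) : trace ℚ E (twist p k E θ * y) =
    (((p : ℚ) ^ 2)⁻¹ * (2 * (k : ℚ))⁻¹) * trace ℚ E (algebraMap L E (2 - θ) * y) := by
  rw [twist, mul_assoc, ← Algebra.smul_def, map_smul, smul_eq_mul]

end Twist

variable {p k l : ℕ} {K L E : Type*} [Field K] [NumberField K] [Field L]
    [NumberField L] [Field E] [NumberField E] [Algebra K E] [Algebra L E]
    {x₀ : K} {x : Fin l → K} {θ : L} {s : Fin k → L}

variable (E x s) in
/-- The products of the two orthogonal systems. -/
def prodBasis (ij : Fin l × Fin k) : E := algebraMap K E (x ij.1) * algebraMap L E (s ij.2)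

theorem trace_mul (S : CompositumSetup (E := E) p k l x₀ x θ s) (a : K) (b : L) :
    trace ℚ E (algebraMap K E a * algebraMap L E b) = trace ℚ K a * trace ℚ L b := by
  rw [← trace_trace (S := K), ← Algebra.smul_def, map_smul, S.trace_eq, smul_eq_mul, mul_comm,
    ← Algebra.smul_def, map_smul, smul_eq_mul, mul_comm]

theorem k_pos (S : CompositumSetup (E := E) p k l x₀ x θ s) : 0 < k := by
  obtain ⟨a, rfl⟩ := S.k_two_pow
  positivity

theorem p_ne_zero (S : CompositumSetup (E := E) p k l x₀ x θ s) : (p : ℚ) ≠ 0 := by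
  have := S.odd.pos
  exact_mod_cast this.ne'

theorem k_ne_zero (S : CompositumSetup (E := E) p k l x₀ x θ s) : 2 * (k : ℚ) ≠ 0 := by
  have := S.k_pos
  positivity

theorem trace_prodBasis (S : CompositumSetup (E := E) p k l x₀ x θ s) (i j : Fin l × Fin k) :
    trace ℚ E (twist p k E θ * prodBasis E x s i * prodBasis E x s j) = if i = j then 1 else 0 := by
  have h : algebraMap L E (2 - θ) * (prodBasis E x s i * prodBasis E x s j) =
      algebraMap K E (x i.1 * x j.1) * algebraMap L E ((2 - θ) * s i.2 * s j.2) := by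
    simp only [prodBasis, map_mul]
    ring
  have hp := S.p_ne_zero
  have hk := S.k_ne_zero
  rw [mul_assoc, trace_twist_mul, h, S.trace_mul, S.trace_x, S.trace_s]
  by_cases h1 : i.1 = j.1 <;> by_cases h2 : i.2 = j.2 <;> simp [h1, h2, Prod.ext_iff]
  have hk2 : (k : ℚ) ≠ 0 := right_ne_zero_of_mul hk
  field_simp

theorem card_eq (S : CompositumSetup (E := E) p k l x₀ x θ s) :
    Fintype.card (Fin l × Fin k) = Module.finrank ℚ E := by
  rw [S.finrank_eq]
  simp [mul_comm]

/-- A rational number with coprime denominators `p ^ 2` and `2k` is an integer. -/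
theorem exists_int_of_mul (S : CompositumSetup (E := E) p k l x₀ x θ s) {q : ℚ} {a b : ℤ}
    (ha : 2 * (k : ℚ) * q = a) (hb : (p : ℚ) ^ 2 * q = b) : ∃ d : ℤ, q = d := by
  obtain ⟨e, he⟩ := S.k_two_pow
  have hc : IsCoprime ((2 * k : ℕ) : ℤ) ((p ^ 2 : ℕ) : ℤ) := by
    rw [Nat.isCoprime_iff_coprime, he, ← pow_succ']
    exact (Nat.coprime_two_left.2 S.odd).pow _ _
  obtain ⟨u, v, huv⟩ := hc
  refine ⟨u * a + v * b, ?_⟩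
  have h : (u : ℚ) * (2 * k) + v * p ^ 2 = 1 := by exact_mod_cast huv
  push_cast
  rw [← ha, ← hb]
  linear_combination -q * h

/-- No description of the integers of the compositum is needed. Factoring the trace through K shows
that 2k times the number is an integer, factoring it through L shows the same for p² times it, and
p² is coprime to 2k. -/
theorem exists_trace_eq_int (S : CompositumSetup (E := E) p k l x₀ x θ s) {Y : E}
    (hY : IsIntegral ℤ Y) :
    ∃ d : ℤ, trace ℚ E (twist p k E θ * (algebraMap K E (x₀ ^ 2) * Y)) = d := by
  have hp := S.p_ne_zero
  have hk := S.k_ne_zero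
  have hk2 : (k : ℚ) ≠ 0 := right_ne_zero_of_mul hk
  have hθ : IsIntegral ℤ (algebraMap L E (2 - θ)) :=
    ((isIntegral_natCast 2).sub S.isIntegral_theta).algebraMap
  have h1 : trace ℚ E (algebraMap L E (2 - θ) * (algebraMap K E (x₀ ^ 2) * Y)) =
      trace ℚ K (x₀ ^ 2 * trace K E (algebraMap L E (2 - θ) * Y)) := by
    rw [← trace_trace (S := K), ← smul_eq_mul (x₀ ^ 2), ← map_smul, Algebra.smul_def]
    congr 2
    ring
  have h2 : trace ℚ E (algebraMap L E (2 - θ) * (algebraMap K E (x₀ ^ 2) * Y)) =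
      trace ℚ L ((2 - θ) * trace L E (algebraMap K E (x₀ ^ 2) * Y)) := by
    rw [← trace_trace (S := L), ← smul_eq_mul (2 - θ), ← map_smul, Algebra.smul_def]
  obtain ⟨a, ha⟩ := S.trace_sq _ (isIntegral_trace (L := K) (hθ.mul hY))
  obtain ⟨b, hb⟩ := S.trace_two_sub _
    (isIntegral_trace (L := L) ((S.isIntegral_x.pow 2).algebraMap.mul hY))
  rw [ha] at h1
  rw [hb] at h2
  refine S.exists_int_of_mul (a := a) (b := b) ?_ ?_
  · rw [trace_twist_mul, h1]
    field_simp
  · rw [trace_twist_mul, h2]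
    field_simp

/-- The module spanned by the products is the principal fractional ideal generated by `x₀`. -/
theorem mem_span_prodBasis_iff (S : CompositumSetup (E := E) p k l x₀ x θ s) (y : E) :
    y ∈ Submodule.span ℤ (Set.range (prodBasis E x s)) ↔
      IsIntegral ℤ (y / algebraMap K E x₀) := by
  have hx0 : algebraMap K E x₀ ≠ 0 := (map_ne_zero _).2 S.ne_zero
  have hB : ∀ i, IsIntegral ℤ (prodBasis E x s i / algebraMap K E x₀) := by
    intro i
    rw [prodBasis, mul_div_right_comm, ← map_div₀]
    exact (S.isIntegral_div _).algebraMap.mul (S.isIntegral_s _).algebraMap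
  constructor
  · intro hy
    obtain ⟨a, rfl⟩ := (Submodule.mem_span_range_iff_exists_fun ℤ).1 hy
    rw [Finset.sum_div]
    refine IsIntegral.sum _ fun i _ => ?_
    rw [smul_div_assoc]
    exact (hB i).smul (a i)
  · intro hy
    -- Writing y and the basis element as integral multiples of x₀ puts the coordinate in the form
    -- Tr(β x₀² Y) with Y integral.
    have h : ∀ i, ∃ d : ℤ, trace ℚ E (twist p k E θ * y * prodBasis E x s i) = d := by
      intro i
      obtain ⟨d, hd⟩ := S.exists_trace_eq_int (hy.mul (hB i))
      refine ⟨d, ?_⟩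
      rw [← hd, map_pow]
      congr 1
      field_simp
    choose d hd using h
    rw [eq_sum_trace_smul (twist p k E θ) (prodBasis E x s) S.card_eq S.trace_prodBasis y]
    refine Submodule.sum_mem _ fun i _ => ?_
    rw [hd, Int.cast_smul_eq_zsmul]
    exact Submodule.smul_mem _ _ (Submodule.subset_span ⟨i, rfl⟩)

end CompositumSetup

end MixedLattice

/-! ### Euclidean lattices from trace forms -/

namespace MixedLattice

/-- The determinant of a linear isometry of a Euclidean space is `± 1`. -/
theorem det_linearIsometryEquiv {n : ℕ}
    (R : EuclideanSpace ℝ (Fin n) ≃ₗᵢ[ℝ] EuclideanSpace ℝ (Fin n)) :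
    LinearMap.det (R.toLinearEquiv : EuclideanSpace ℝ (Fin n) →ₗ[ℝ] EuclideanSpace ℝ (Fin n)) = 1 ∨
    LinearMap.det (R.toLinearEquiv : EuclideanSpace ℝ (Fin n) →ₗ[ℝ] EuclideanSpace ℝ (Fin n)) =
      -1 := by
  set a := EuclideanSpace.basisFun (Fin n) ℝ
  have h := a.det_to_matrix_orthonormalBasis_real (a.map R)
  have h2 := a.toBasis.det_comp
    (R.toLinearEquiv : EuclideanSpace ℝ (Fin n) →ₗ[ℝ] EuclideanSpace ℝ (Fin n)) a.toBasis
  rw [a.toBasis.det_self, mul_one] at h2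
  rw [← h2]
  have h3 : ((R.toLinearEquiv : EuclideanSpace ℝ (Fin n) →ₗ[ℝ] EuclideanSpace ℝ (Fin n)) ∘
      a.toBasis) = a.map R := by
    ext i
    simp
  rw [h3]
  exact h

/-- The reflection in a coordinate hyperplane preserves the cubic lattice. -/
theorem reflection_image_cubicLattice {n : ℕ} (i : Fin n) :
    (Submodule.reflection (ℝ ∙ EuclideanSpace.single i (1 : ℝ))ᗮ) '' cubicLattice n =
      cubicLattice n := by
  have h : ∀ v ∈ cubicLattice n,
      (Submodule.reflection (ℝ ∙ EuclideanSpace.single i (1 : ℝ))ᗮ) v ∈ cubicLattice n := by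
    intro v hv j
    rw [Submodule.reflection_orthogonal_apply, Submodule.reflection_singleton_apply]
    obtain ⟨a, ha⟩ := hv j
    obtain ⟨b, hb⟩ := hv i
    by_cases hij : j = i
    · subst hij
      exact ⟨-b, by simp [hb, EuclideanSpace.inner_single_left]; ring⟩
    · exact ⟨a, by simp [ha, hij]⟩
  apply Set.Subset.antisymm
  · rintro _ ⟨v, hv, rfl⟩
    exact h v hv
  · intro v hv
    exact ⟨_, h v hv, Submodule.reflection_reflection _ v⟩

/-- The image of the cubic lattice under any linear isometry is a rotated version of it. -/
theorem isRotatedVersion_of_isometry {n : ℕ} (hn : 0 < n) {Λ : Set (EuclideanSpace ℝ (Fin n))}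
    (R : EuclideanSpace ℝ (Fin n) ≃ₗᵢ[ℝ] EuclideanSpace ℝ (Fin n))
    (hR : Λ = R '' cubicLattice n) : IsRotatedVersion Λ (cubicLattice n) := by
  rcases det_linearIsometryEquiv R with h | h
  · exact ⟨R, h, hR⟩
  -- A coordinate reflection preserves ℤⁿ, so composing with it first corrects the determinant
  -- without changing the image.
  · set D := Submodule.reflection (ℝ ∙ EuclideanSpace.single (⟨0, hn⟩ : Fin n) (1 : ℝ))ᗮ with hD
    refine ⟨D.trans R, ?_, ?_⟩
    · have h1 : ((D.trans R).toLinearEquiv :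
          EuclideanSpace ℝ (Fin n) →ₗ[ℝ] EuclideanSpace ℝ (Fin n)) =
          (R.toLinearEquiv : EuclideanSpace ℝ (Fin n) →ₗ[ℝ] EuclideanSpace ℝ (Fin n)) ∘ₗ
          (D.toLinearEquiv : EuclideanSpace ℝ (Fin n) →ₗ[ℝ] EuclideanSpace ℝ (Fin n)) := rfl
      have h2 := Submodule.det_reflection
        (ℝ ∙ EuclideanSpace.single (⟨0, hn⟩ : Fin n) (1 : ℝ))ᗮ
      rw [Submodule.orthogonal_orthogonal, finrank_span_singleton (by simp), pow_one] at h2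
      rw [h1, LinearMap.det_comp, h]
      erw [h2]
      norm_num
    · rw [hR, LinearIsometryEquiv.coe_trans, Set.image_comp, hD, reflection_image_cubicLattice]

variable {E : Type*} [Field E] {n : ℕ}

theorem hasMaximumDiversity_algebraicLattice (s : Fin n ≃ (E →+* ℝ)) {β : E}
    (hβ : ∀ i, 0 < s i β) (M : Submodule ℤ E) :
    HasMaximumDiversity (algebraicLattice s β M) := by
  rintro _ ⟨y, -, rfl⟩ hy i
  have hy0 : y ≠ 0 := by
    rintro rfl
    apply hy
    ext j
    simp [twistedHom]
  exact mul_ne_zero (Real.sqrt_pos.2 (hβ i)).ne' ((map_ne_zero _).2 hy0)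

variable [NumberField E]

/-- A full set of real embeddings, as the set of all complex embeddings. -/
theorem bijective_ofReal_comp (hn : Module.finrank ℚ E = n) (s : Fin n ≃ (E →+* ℝ)) :
    Function.Bijective fun i => (Complex.ofRealHom.comp (s i)).toRatAlgHom := by
  rw [Fintype.bijective_iff_injective_and_card]
  refine ⟨fun i j hij => s.injective ?_, by rw [Fintype.card_fin, AlgHom.card, hn]⟩
  ext y
  have := DFunLike.congr_fun hij y
  exact Complex.ofReal_injective this

/-- A full set of real embeddings computes the trace. -/
theorem sum_embeddings_eq_trace (hn : Module.finrank ℚ E = n) (s : Fin n ≃ (E →+* ℝ)) (y : E) :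
    ∑ i, s i y = (Algebra.trace ℚ E y : ℝ) := by
  have h := trace_eq_sum_embeddings (K := ℚ) ℂ (x := y)
  rw [← (bijective_ofReal_comp hn s).sum_comp] at h
  apply Complex.ofReal_injective
  push_cast
  exact h.symm

theorem prod_embeddings_eq_norm (hn : Module.finrank ℚ E = n) (s : Fin n ≃ (E →+* ℝ)) (y : E) :
    ∏ i, s i y = (Algebra.norm ℚ y : ℝ) := by
  have h := Algebra.norm_eq_prod_embeddings ℚ ℂ y
  rw [← (bijective_ofReal_comp hn s).prod_comp] at h
  apply Complex.ofReal_injective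
  push_cast
  exact h.symm

theorem twistedHom_sum {ι : Type*} [Fintype ι] (s : Fin n ≃ (E →+* ℝ)) (β : E) (B : ι → E)
    (a : ι → ℤ) :
    twistedHom s β (∑ i, a i • B i) = ∑ i, (a i : ℝ) • twistedHom s β (B i) := by
  ext j
  simp [twistedHom, Finset.mul_sum]
  refine Finset.sum_congr rfl fun i _ => ?_
  ring

/-- Since every embedding of β is positive, the square roots combine and the inner product of two
twisted vectors is Tr(βuv). An orthonormal `ℤ`-basis for this form therefore maps to an orthonormal
basis of ℝⁿ. -/
theorem isRotatedVersion_algebraicLattice {ι : Type*} [Fintype ι] [DecidableEq ι]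
    (hn : Module.finrank ℚ E = n) (hn0 : 0 < n) (s : Fin n ≃ (E →+* ℝ)) {β : E}
    (hβ : ∀ i, 0 < s i β) (B : ι → E) (hcard : Fintype.card ι = n)
    (hB : ∀ i j, Algebra.trace ℚ E (β * B i * B j) = if i = j then 1 else 0) :
    IsRotatedVersion (algebraicLattice s β (Submodule.span ℤ (Set.range B))) (cubicLattice n) := by
  let e : Fin n ≃ ι := (Fintype.equivFinOfCardEq hcard).symm
  let v : Fin n → EuclideanSpace ℝ (Fin n) := fun i => twistedHom s β (B (e i))
  have hv : Orthonormal ℝ v := by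
    rw [orthonormal_iff_ite]
    intro i j
    have h : inner ℝ (v i) (v j) = ∑ a, s a (β * B (e i) * B (e j)) := by
      simp only [v, twistedHom, PiLp.inner_apply, RCLike.inner_apply, conj_trivial, map_mul]
      refine Finset.sum_congr rfl fun a _ => ?_
      have := Real.mul_self_sqrt (hβ a).le
      linear_combination (s a (B (e i)) * s a (B (e j))) * this
    rw [h, sum_embeddings_eq_trace hn, hB]
    simp only [e.injective.eq_iff]
    split_ifs <;> simp
  let b : OrthonormalBasis (Fin n) ℝ (EuclideanSpace ℝ (Fin n)) :=
    OrthonormalBasis.mk hv (hv.linearIndependent.span_eq_top_of_card_eq_finrank' (by simp)).ge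
  refine isRotatedVersion_of_isometry hn0 b.repr.symm ?_
  have hb : ∀ w, b.repr.symm w = ∑ i, w i • v i := by
    intro w
    rw [← b.sum_repr_symm]
    simp [b]
  ext w
  constructor
  · rintro ⟨y, hy, rfl⟩
    obtain ⟨a, rfl⟩ := (Submodule.mem_span_range_iff_exists_fun ℤ).1 hy
    refine ⟨WithLp.toLp 2 fun i => (a (e i) : ℝ), fun i => ⟨a (e i), rfl⟩, ?_⟩
    rw [hb, twistedHom_sum, ← e.sum_comp]
  · rintro ⟨u, hu, rfl⟩
    choose a ha using hu
    refine ⟨∑ i, a (e.symm i) • B i, (Submodule.mem_span_range_iff_exists_fun ℤ).2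
      ⟨fun i => a (e.symm i), rfl⟩, ?_⟩
    rw [hb, twistedHom_sum, ← e.sum_comp]
    simp [ha, v]

/-- The coordinate product at y has absolute value √N(β) |N(y)|. For nonzero y in the ideal (x),
N(y/x) is a nonzero integer, so the minimum is attained at x. -/
theorem minProductDistance_algebraicLattice (hn : Module.finrank ℚ E = n)
    (s : Fin n ≃ (E →+* ℝ)) (hn0 : 0 < n) {β x : E}
    (hβ : ∀ i, 0 < s i β) (M : Submodule ℤ E) (hx : x ≠ 0)
    (hM : ∀ y, y ∈ M ↔ IsIntegral ℤ (y / x)) :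
    minProductDistance (algebraicLattice s β M) =
      √(Algebra.norm ℚ β : ℝ) * |(Algebra.norm ℚ x : ℝ)| := by
  have hprod : ∀ y, |∏ i, twistedHom s β y i| =
      √(Algebra.norm ℚ β : ℝ) * |(Algebra.norm ℚ y : ℝ)| := by
    intro y
    have h1 : ∏ i, twistedHom s β y i = (∏ i, √(s i β)) * ∏ i, s i y := by
      rw [← Finset.prod_mul_distrib]
      rfl
    rw [h1, abs_mul, prod_embeddings_eq_norm hn, ← Real.sqrt_prod _ (fun i _ => (hβ i).le),
      prod_embeddings_eq_norm hn, abs_of_nonneg (Real.sqrt_nonneg _)]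
  refine IsLeast.csInf_eq ⟨?_, ?_⟩
  · refine ⟨twistedHom s β x, ⟨x, (hM x).2 (by rw [div_self hx]; exact isIntegral_one), rfl⟩, ?_, ?_⟩
    · intro h
      have h2 := congrArg (fun v : EuclideanSpace ℝ (Fin n) => v ⟨0, hn0⟩) h
      exact mul_ne_zero (Real.sqrt_pos.2 (hβ _)).ne' ((map_ne_zero _).2 hx) h2
    · rw [hprod]
  · rintro d ⟨_, ⟨y, hy, rfl⟩, hy0, rfl⟩
    rw [hprod]
    refine mul_le_mul_of_nonneg_left ?_ (Real.sqrt_nonneg _)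
    have hy1 : y ≠ 0 := by
      rintro rfl
      apply hy0
      ext j
      simp [twistedHom]
    obtain ⟨a, ha⟩ := exists_int_of_isIntegral (Algebra.isIntegral_norm ℚ ((hM y).1 hy))
    have ha0 : a ≠ 0 := by
      rintro rfl
      rw [Int.cast_zero, Algebra.norm_eq_zero_iff] at ha
      exact div_ne_zero hy1 hx ha
    rw [← div_mul_cancel₀ y hx, map_mul, ha]
    push_cast
    rw [abs_mul]
    refine le_mul_of_one_le_left (abs_nonneg _) ?_
    exact_mod_cast Int.one_le_abs ha0

end MixedLattice

/-! ### Total reality and total positivity -/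

open scoped ComplexConjugate

/-- A complex embedding extends to an algebraic extension. -/
theorem exists_extension {F F' : Type*} [Field F] [Field F'] [Algebra F F']
    [Algebra.IsAlgebraic F F'] (φ : F →+* ℂ) :
    ∃ χ : F' →+* ℂ, ∀ y, χ (algebraMap F F' y) = φ y := by
  let := φ.toAlgebra
  let χ : F' →ₐ[F] ℂ := IsAlgClosed.lift
  exact ⟨χ, fun y => χ.commutes y⟩

theorem conj_eq_inv_of_pow_eq_one {z : ℂ} {n : ℕ} (hn : n ≠ 0) (hz : z ^ n = 1) :
    conj z = z⁻¹ :=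
  (Complex.inv_eq_conj (Complex.norm_eq_one_of_pow_eq_one hz hn)).symm

namespace CyclicSetup

variable {p l c r : ℕ} {P : Type*} [Field P] [NumberField P] {ζ : P} {σ : P ≃ₐ[ℚ] P}
  [IsCyclotomicExtension {p} ℚ P]

/-- The fixed field is totally real. -/
theorem conj_embedding (S : CyclicSetup p l c r ζ σ) (φ : fixed l σ →+* ℂ) (y : fixed l σ) :
    (starRingEnd ℂ) (φ y) = φ y := by
  obtain ⟨χ, hχ⟩ := exists_extension (F' := P) φ
  have : NeZero p := ⟨S.pos.ne'⟩
  -- Complex conjugation is σ^(cl) seen through any embedding, and σ^(cl) is a power of σ^l, which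
  -- acts trivially on the fixed field.
  have h : ((starRingEnd ℂ).comp χ).toRatAlgHom =
      (χ.comp ((σ ^ (c * l) : P ≃ₐ[ℚ] P) : P →+* P)).toRatAlgHom := by
    apply (S.prim.powerBasis ℚ).algHom_ext
    rw [IsPrimitiveRoot.powerBasis_gen]
    change (starRingEnd ℂ) (χ ζ) = χ ((σ ^ (c * l)) ζ)
    rw [S.sigma_pow_zeta, S.zeta_pow_half, map_inv₀]
    exact conj_eq_inv_of_pow_eq_one S.pos.ne' (by rw [← map_pow, S.prim.pow_eq_one, map_one])
  have h2 : (starRingEnd ℂ) (χ y) = χ ((σ ^ (c * l)) y) := DFunLike.congr_fun h (y : P)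
  have h3 : ∀ n, (σ ^ (n * l)) (y : P) = y := by
    intro n
    induction n with
    | zero => simp
    | succ n ih => rw [Nat.succ_mul, sigma_add_fixed, ih]
  rw [h3] at h2
  rw [← hχ]
  exact h2

end CyclicSetup

namespace TwoPowSetup

variable {m : ℕ} {C L : Type*} [Field C] [Field L] [NumberField L] [Algebra L C] {ω : C} {θ : L}
  [NumberField C]

theorem exists_embedding_theta (S : TwoPowSetup m ω θ) (φ : L →+* ℂ) :
    ∃ z : ℂ, ‖z‖ = 1 ∧ φ θ = z + conj z := by
  obtain ⟨χ, hχ⟩ := exists_extension (F' := C) φ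
  have hz : (χ ω) ^ 2 ^ m = 1 := by rw [← map_pow, S.prim.pow_eq_one, map_one]
  refine ⟨χ ω, Complex.norm_eq_one_of_pow_eq_one hz (by positivity), ?_⟩
  rw [conj_eq_inv_of_pow_eq_one (by positivity) hz, ← hχ, S.map_theta, map_add, map_inv₀]

/-- The field generated by `θ` is totally real. -/
theorem conj_embedding (S : TwoPowSetup m ω θ) (φ : L →+* ℂ) (y : L) :
    (starRingEnd ℂ) (φ y) = φ y := by
  have h : ((starRingEnd ℂ).comp φ).toRatAlgHom = φ.toRatAlgHom := by
    apply S.algHom_ext_theta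
    obtain ⟨z, -, hz⟩ := S.exists_embedding_theta φ
    change (starRingEnd ℂ) (φ θ) = φ θ
    rw [hz, map_add, Complex.conj_conj, add_comm]
  exact DFunLike.congr_fun h y

/-- The image of θ is 2 Re z with |z| = 1, so 2 - θ maps to a nonnegative number; it is nonzero
because 2 - θ ≠ 0. -/
theorem embedding_two_sub_pos (S : TwoPowSetup m ω θ) (φ : L →+* ℝ) : 0 < φ (2 - θ) := by
  obtain ⟨z, hz1, hz⟩ := S.exists_embedding_theta (Complex.ofRealHom.comp φ)
  have h1 : φ θ = 2 * z.re := by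
    rw [Complex.add_conj] at hz
    exact Complex.ofReal_injective hz
  have h2 : z.re ≤ 1 := hz1 ▸ Complex.re_le_norm z
  have h3 : φ (2 - θ) ≠ 0 := (map_ne_zero φ).2 S.two_sub_ne_zero
  have h4 : φ (2 - θ) = 2 - φ θ := by rw [map_sub, map_ofNat]
  exact lt_of_le_of_ne (by rw [h4, h1]; linarith) h3.symm

end TwoPowSetup

namespace MixedLattice

/-- A number field all of whose complex embeddings are real has as many real embeddings as its
degree. -/
theorem nonempty_equiv_real_embeddings {E : Type*} [Field E] [NumberField E] {n : ℕ}
    (hn : Module.finrank ℚ E = n) (hE : ∀ (φ : E →+* ℂ) (y : E), (starRingEnd ℂ) (φ y) = φ y) :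
    Nonempty (Fin n ≃ (E →+* ℝ)) := by
  let f : (E →+* ℝ) → (E →ₐ[ℚ] ℂ) := fun s => (Complex.ofRealHom.comp s).toRatAlgHom
  have hf : Function.Bijective f := by
    constructor
    · intro s t hst
      ext y
      exact Complex.ofReal_injective (DFunLike.congr_fun hst y)
    · intro φ
      have h : ∀ y, ((φ y).re : ℂ) = φ y := fun y => Complex.conj_eq_iff_re.1 (hE φ y)
      refine ⟨{ toFun := fun y => (φ y).re, map_one' := ?_, map_mul' := ?_, map_zero' := ?_,
                map_add' := ?_ }, ?_⟩
      · simp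
      · intro a b
        apply Complex.ofReal_injective
        rw [h, map_mul, Complex.ofReal_mul, h, h]
      · simp
      · intro a b
        simp
      · ext y
        exact h y
  have hc : Fintype.card (E →ₐ[ℚ] ℂ) = n := by rw [AlgHom.card, hn]
  exact ⟨(Fintype.equivFinOfCardEq hc).symm.trans (Equiv.ofBijective f hf).symm⟩

end MixedLattice

/-! ### The concrete subfields of ℂ -/

namespace MixedLattice

theorem isPrimitiveRoot_zeta {N : ℕ} (hN : N ≠ 0) : IsPrimitiveRoot (zeta N) N :=
  Complex.isPrimitiveRoot_exp N hN

theorem isPrimitiveRoot_zetaGen {N : ℕ} (hN : N ≠ 0) : IsPrimitiveRoot (zetaGen N) N :=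
  IsPrimitiveRoot.of_map_of_injective (f := algebraMap (cyclo N) ℂ) (isPrimitiveRoot_zeta hN)
    (FaithfulSMul.algebraMap_injective _ _)

theorem isIntegral_zeta {N : ℕ} (hN : N ≠ 0) : IsIntegral ℚ (zeta N) :=
  ((isPrimitiveRoot_zeta hN).isIntegral (Nat.pos_of_ne_zero hN)).tower_top

theorem isCyclotomicExtension_cyclo {N : ℕ} (hN : N ≠ 0) :
    IsCyclotomicExtension {N} ℚ (cyclo N) := by
  have : NeZero N := ⟨hN⟩
  change IsCyclotomicExtension {N} ℚ (cyclo N).toSubalgebra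
  rw [IntermediateField.adjoin_simple_toSubalgebra_of_isAlgebraic (isIntegral_zeta hN).isAlgebraic]
  exact (isPrimitiveRoot_zeta hN).adjoin_isCyclotomicExtension ℚ

theorem numberField_cyclo {N : ℕ} (hN : N ≠ 0) : NumberField (cyclo N) :=
  have := isCyclotomicExtension_cyclo hN
  have : NeZero N := ⟨hN⟩
  IsCyclotomicExtension.numberField {N} ℚ (cyclo N)

theorem numberField_of_finiteDimensional (F : IntermediateField ℚ ℂ) [FiniteDimensional ℚ F] :
    NumberField F where
  to_charZero := inferInstance
  to_finiteDimensional := ‹_›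

/-- Bookkeeping for the hypotheses on `p`, `l`, `r`. -/
theorem exists_cyclicSetup {l p r : ℕ} (hl : Odd l) (hl1 : 1 < l) (hp : p.Prime)
    (hpl : p ≡ 1 [MOD l]) (hr : orderOf (r : ZMod p) = p - 1) (σ : cyclo p ≃ₐ[ℚ] cyclo p)
    (hσ : σ (zetaGen p) = zetaGen p ^ r) : ∃ c, CyclicSetup p l c r (zetaGen p) σ := by
  obtain ⟨t, ht⟩ := (Nat.modEq_iff_dvd' hp.one_lt.le).1 hpl.symm
  have hp2 : p ≠ 2 := by
    rintro rfl
    have : l ∣ 1 := ⟨t, ht⟩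
    have := Nat.le_of_dvd one_pos this
    omega
  have heven : Even (l * t) := by
    rw [← ht]
    exact (hp.eq_two_or_odd'.resolve_left hp2).tsub_odd odd_one
  have ht2 : Even t := (Nat.even_mul.1 heven).resolve_left (Nat.not_even_iff_odd.2 hl)
  obtain ⟨c, rfl⟩ := ht2
  refine ⟨c, hp, ?_, hl, hl1, hr, isPrimitiveRoot_zetaGen hp.ne_zero, hσ⟩
  have := hp.one_lt
  have h2 : l * (c + c) = 2 * c * l := by ring
  omega

variable {p l c r : ℕ} {σ : cyclo p ≃ₐ[ℚ] cyclo p} {lam : ℤ} [NumberField (cyclo p)]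

theorem xElt_eq (S : CyclicSetup p l c r (zetaGen p) σ) :
    xElt l r lam σ = CyclicSetup.traceElt l c r (zetaGen p) σ lam := by
  have h : (p - 1) / 2 = c * l := by
    have := S.sub_one
    rw [mul_assoc] at this
    omega
  rw [xElt, CyclicSetup.traceElt, zElt, alphaElt, CyclicSetup.gauss, h]

variable (l σ) in
/-- The fixed field of `⟨σ ^ l⟩` inside `ℚ(ζ_p)` and inside `ℂ`. -/
noncomputable def fixedEquiv : fixedK l σ ≃+* fieldK l σ :=
  RingEquiv.ofBijective
    { toFun := fun y => ⟨((y : cyclo p) : ℂ), (IntermediateField.mem_lift _).2 y.2⟩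
      map_one' := rfl
      map_mul' := fun _ _ => rfl
      map_zero' := rfl
      map_add' := fun _ _ => rfl : fixedK l σ →+* fieldK l σ }
    ⟨RingHom.injective _, fun y => by
      have hy : (y : ℂ) ∈ cyclo p := IntermediateField.lift_le _ y.2
      exact ⟨⟨⟨y, hy⟩, (IntermediateField.mem_lift (⟨y, hy⟩ : cyclo p)).1 y.2⟩, rfl⟩⟩

variable (l σ) in
noncomputable def fixedAlgEquiv : fixedK l σ ≃ₐ[ℚ] fieldK l σ :=
  AlgEquiv.ofRingEquiv (f := fixedEquiv l σ) fun q => by simp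

theorem fixedAlgEquiv_conj (S : CyclicSetup p l c r (zetaGen p) σ) (i : ℕ) :
    fixedAlgEquiv l σ (CyclicSetup.conj i (CyclicSetup.traceElt l c r (zetaGen p) σ lam)) =
      conjX l r lam σ i := by
  rw [← xElt_eq (lam := lam) S]
  rfl

theorem finrank_fieldRange {K E : Type*} [Field K] [NumberField K] [Field E] [NumberField E]
    (f : K →ₐ[ℚ] E) : Module.finrank ℚ f.fieldRange = Module.finrank ℚ K :=
  (AlgEquiv.ofInjectiveField f).symm.toLinearEquiv.finrank_eq

/-- Linear disjointness of two subfields of coprime degrees, in terms of the trace. -/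
theorem trace_algebraMap_of_coprime {K L E : Type*} [Field K] [NumberField K] [Field L]
    [NumberField L] [Field E] [NumberField E] [Algebra K E] [Algebra L E]
    (hcop : (Module.finrank ℚ K).Coprime (Module.finrank ℚ L))
    (htop : (IsScalarTower.toAlgHom ℚ K E).fieldRange ⊔ (IsScalarTower.toAlgHom ℚ L E).fieldRange = ⊤)
    (b : L) : Algebra.trace K E (algebraMap L E b) = algebraMap ℚ K (Algebra.trace ℚ L b) := by
  set f := IsScalarTower.toAlgHom ℚ K E
  set g := IsScalarTower.toAlgHom ℚ L E
  -- Coprime degrees force linear disjointness; the rest transports the resulting trace identity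
  -- from the image subfields to K and L.
  have hd : f.fieldRange.LinearDisjoint g.fieldRange :=
    IntermediateField.LinearDisjoint.of_finrank_coprime (by
      rwa [finrank_fieldRange, finrank_fieldRange])
  let ef : K ≃ₐ[ℚ] f.fieldRange := AlgEquiv.ofInjectiveField f
  let eg : L ≃ₐ[ℚ] g.fieldRange := AlgEquiv.ofInjectiveField g
  have h1 := hd.trace_algebraMap htop (eg b)
  have h2 := Algebra.trace_eq_of_ringEquiv (ef : K ≃+* f.fieldRange) (C := E) (by rfl)
    (algebraMap L E b)
  have h3 := Algebra.trace_eq_of_algEquiv eg b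
  apply ef.injective
  exact h2.trans (h1.trans ((congrArg (algebraMap ℚ f.fieldRange) h3).trans (ef.commutes _).symm))

end MixedLattice

namespace MixedLattice

variable {p l c r m : ℕ} {σ : cyclo p ≃ₐ[ℚ] cyclo p} {lam : ℤ}

theorem numberField_fieldK [NumberField (cyclo p)] : NumberField (fieldK l σ) :=
  NumberField.of_ringEquiv (fixedK l σ) (fieldK l σ) (fixedEquiv l σ)

theorem isIntegral_theta (m : ℕ) : IsIntegral ℤ (theta m) :=
  ((isPrimitiveRoot_zeta (N := 2 ^ m) (by positivity)).isIntegral (by positivity)).add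
    ((isPrimitiveRoot_zeta (N := 2 ^ m) (by positivity)).inv.isIntegral (by positivity))

theorem eq_top_of_le_map {A : IntermediateField ℚ ℂ} {F : IntermediateField ℚ A}
    (h : A ≤ F.map (IsScalarTower.toAlgHom ℚ A ℂ)) : F = ⊤ := by
  rw [eq_top_iff]
  intro y _
  obtain ⟨z, hz, hzy⟩ := h y.2
  rwa [← Subtype.ext hzy]

theorem numberField_fieldL (m : ℕ) : NumberField (fieldL m) :=
  have : FiniteDimensional ℚ (fieldL m) :=
    IntermediateField.adjoin.finiteDimensional (isIntegral_theta m).tower_top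
  numberField_of_finiteDimensional _

theorem numberField_fieldKL [NumberField (fieldK l σ)] [NumberField (fieldL m)] :
    NumberField (fieldKL l m σ) :=
  have : FiniteDimensional ℚ (fieldK l σ) := NumberField.to_finiteDimensional
  have : FiniteDimensional ℚ (fieldL m) := NumberField.to_finiteDimensional
  have : FiniteDimensional ℚ (fieldKL l m σ) := IntermediateField.finiteDimensional_sup _ _
  numberField_of_finiteDimensional _

/-- `θ` as an element of `𝕃`. -/
noncomputable abbrev thetaL (m : ℕ) : fieldL m := IntermediateField.AdjoinSimple.gen ℚ (theta m)

theorem theta_mem_cyclo (m : ℕ) : fieldL m ≤ cyclo (2 ^ m) := by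
  rw [IntermediateField.adjoin_simple_le_iff]
  exact add_mem (IntermediateField.mem_adjoin_simple_self _ _)
    (inv_mem (IntermediateField.mem_adjoin_simple_self _ _))

variable (m) in
/-- `ℚ(ζ_{2^m})` as an extension of `𝕃`. -/
@[reducible] noncomputable def algebraCyclo : Algebra (fieldL m) (cyclo (2 ^ m)) :=
  (IntermediateField.inclusion (theta_mem_cyclo m)).toRingHom.toAlgebra

variable (l m σ) in
/-- The compositum as an extension of `𝕂`. -/
@[reducible] noncomputable def algebraK : Algebra (fieldK l σ) (fieldKL l m σ) :=
  (inclK l m σ).toRingHom.toAlgebra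

variable (l m σ) in
/-- The compositum as an extension of `𝕃`. -/
@[reducible] noncomputable def algebraL : Algebra (fieldL m) (fieldKL l m σ) :=
  (inclL l m σ).toRingHom.toAlgebra

section

attribute [local instance] algebraCyclo algebraK algebraL

theorem twoPowSetup (hm : 3 ≤ m) [NumberField (fieldL m)] :
    TwoPowSetup m (zetaGen (2 ^ m)) (thetaL m) where
  le := hm
  prim := isPrimitiveRoot_zetaGen (by positivity)
  map_theta := rfl
  adjoin_theta := by
    refine eq_top_of_le_map (IntermediateField.adjoin_simple_le_iff.2 ?_)
    exact ⟨thetaL m, IntermediateField.mem_adjoin_simple_self ℚ (thetaL m), rfl⟩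

theorem fieldRange_sup_fieldRange [NumberField (fieldK l σ)] [NumberField (fieldL m)]
    [NumberField (fieldKL l m σ)] :
    (IsScalarTower.toAlgHom ℚ (fieldK l σ) (fieldKL l m σ)).fieldRange ⊔
      (IsScalarTower.toAlgHom ℚ (fieldL m) (fieldKL l m σ)).fieldRange = ⊤ := by
  set A := (IsScalarTower.toAlgHom ℚ (fieldK l σ) (fieldKL l m σ)).fieldRange
  set B := (IsScalarTower.toAlgHom ℚ (fieldL m) (fieldKL l m σ)).fieldRange
  refine eq_top_of_le_map (sup_le ?_ ?_)
  · intro y hy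
    exact ⟨inclK l m σ ⟨y, hy⟩, (le_sup_left : A ≤ A ⊔ B) ⟨⟨y, hy⟩, rfl⟩, rfl⟩
  · intro y hy
    exact ⟨inclL l m σ ⟨y, hy⟩, (le_sup_right : B ≤ A ⊔ B) ⟨⟨y, hy⟩, rfl⟩, rfl⟩

theorem finrank_fieldK (S : CyclicSetup p l c r (zetaGen p) σ) [NumberField (cyclo p)]
    [IsCyclotomicExtension {p} ℚ (cyclo p)] : Module.finrank ℚ (fieldK l σ) = l := by
  exact (fixedAlgEquiv l σ).symm.toLinearEquiv.finrank_eq.trans S.finrank_fixed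

theorem coprime_finrank (S : CyclicSetup p l c r (zetaGen p) σ) (hm : 3 ≤ m)
    [NumberField (cyclo p)] [IsCyclotomicExtension {p} ℚ (cyclo p)]
    [NumberField (fieldL m)] :
    (Module.finrank ℚ (fieldK l σ)).Coprime (Module.finrank ℚ (fieldL m)) := by
  have := numberField_cyclo (N := 2 ^ m) (by positivity)
  have := isCyclotomicExtension_cyclo (N := 2 ^ m) (by positivity)
  rw [finrank_fieldK S, (twoPowSetup hm).finrank_eq (C := cyclo (2 ^ m))]
  exact (Nat.coprime_two_right.2 S.odd).pow_right _

theorem finrank_fieldKL (S : CyclicSetup p l c r (zetaGen p) σ) (hm : 3 ≤ m)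
    [NumberField (cyclo p)] [IsCyclotomicExtension {p} ℚ (cyclo p)]
    [NumberField (fieldL m)] :
    Module.finrank ℚ (fieldKL l m σ) = 2 ^ (m - 2) * l := by
  have := numberField_cyclo (N := 2 ^ m) (by positivity)
  have := isCyclotomicExtension_cyclo (N := 2 ^ m) (by positivity)
  have h := (IntermediateField.LinearDisjoint.of_finrank_coprime
    (A := fieldK l σ) (L := fieldL m) (coprime_finrank S hm)).finrank_sup
  refine h.trans ?_
  rw [mul_comm]
  congr 1
  · exact (twoPowSetup hm).finrank_eq (C := cyclo (2 ^ m))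
  · exact finrank_fieldK S

/-- Everything proved for the fixed field and for ℚ(θ) is transported to the subfields of ℂ; the
exponents in the two norm formulas are the relative degrees from the tower law. -/
theorem compositumSetup (S : CyclicSetup p l c r (zetaGen p) σ) (hm : 3 ≤ m)
    (hlam : lam * ((r : ℤ) - 1) ≡ 1 [ZMOD p])
    (hu : IsIntegral ℤ (σ (xElt l r lam σ : cyclo p) / (xElt l r lam σ : cyclo p)))
    [NumberField (cyclo p)] [IsCyclotomicExtension {p} ℚ (cyclo p)]
    [NumberField (fieldK l σ)] [NumberField (fieldL m)] [NumberField (fieldKL l m σ)] :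
    CompositumSetup (E := fieldKL l m σ) p (2 ^ (m - 2)) l (conjX l r lam σ 0)
      (fun i : Fin l => conjX l r lam σ i) (thetaL m)
      (fun j : Fin (2 ^ (m - 2)) => oddSum (thetaL m) j) := by
  have := numberField_cyclo (N := 2 ^ m) (by positivity)
  have := isCyclotomicExtension_cyclo (N := 2 ^ m) (by positivity)
  have T := twoPowSetup hm
  have hθ : IsIntegral ℤ (thetaL m) :=
    (isIntegral_algebraMap_iff (FaithfulSMul.algebraMap_injective (fieldL m) ℂ)).1
      (isIntegral_theta m)
  have hu' := hu
  rw [xElt_eq S] at hu'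
  have hx : ∀ i, conjX l r lam σ i = fixedAlgEquiv l σ
      (CyclicSetup.conj i (CyclicSetup.traceElt l c r (zetaGen p) σ lam)) :=
    fun i => (fixedAlgEquiv_conj S i).symm
  have hK := finrank_fieldK S
  have hL := T.finrank_eq (C := cyclo (2 ^ m))
  have hE := finrank_fieldKL S hm
  have hc0 : CyclicSetup.conj 0 (CyclicSetup.traceElt l c r (zetaGen p) σ lam) =
    CyclicSetup.traceElt l c r (zetaGen p) σ lam := rfl
  refine
    { odd := S.prime.odd_of_ne_two S.ne_two
      k_two_pow := ⟨_, rfl⟩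
      finrank_eq := hE
      trace_eq := trace_algebraMap_of_coprime (coprime_finrank S hm) fieldRange_sup_fieldRange
      norm_K := ?_
      norm_L := ?_
      ne_zero := ?_
      isIntegral_x := ?_
      isIntegral_div := ?_
      trace_x := ?_
      trace_sq := ?_
      isIntegral_s := fun j => isIntegral_oddSum hθ j
      isIntegral_theta := hθ
      trace_s := ?_
      trace_two_sub := ?_ }
  · intro a
    rw [← Algebra.norm_norm (S := fieldK l σ), Algebra.norm_algebraMap, map_pow]
    congr 1
    have := Module.finrank_mul_finrank ℚ (fieldK l σ) (fieldKL l m σ)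
    rw [hK, hE, mul_comm] at this
    exact Nat.eq_of_mul_eq_mul_right (by have := S.one_lt; omega) this
  · intro b
    rw [← Algebra.norm_norm (S := fieldL m), Algebra.norm_algebraMap, map_pow]
    congr 1
    have := Module.finrank_mul_finrank ℚ (fieldL m) (fieldKL l m σ)
    rw [hL, hE] at this
    exact Nat.eq_of_mul_eq_mul_left (by positivity) this
  · rw [hx, map_ne_zero, hc0]
    exact S.traceElt_ne_zero hlam
  · rw [hx]
    refine IsIntegral.map (fixedAlgEquiv l σ) ?_
    rw [hc0]
    -- x is integral because its square (-1)^c p η² is.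
    refine CyclicSetup.isIntegral_fixed (IsIntegral.of_pow two_pos ?_)
    rw [S.sq_traceElt hlam]
    exact ((isIntegral_one.neg.pow c).mul (isIntegral_natCast p)).mul (S.isIntegral_period.pow 2)
  · intro i
    rw [hx, hx, ← map_div₀]
    refine IsIntegral.map (fixedAlgEquiv l σ) (CyclicSetup.isIntegral_fixed ?_)
    exact (S.unitRatio_traceElt hlam hu' i).1
  · intro i j
    rw [hx, hx, ← map_mul]
    exact (Algebra.trace_eq_of_algEquiv _ _).trans (S.trace_conj_mul_conj hlam i j)
  · intro W hW
    obtain ⟨a, ha⟩ := S.trace_sq_traceElt_mul_of_isIntegral hlam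
      (hW.map (fixedAlgEquiv l σ).symm)
    refine ⟨a, ?_⟩
    rw [hx, hc0, ← ha, ← Algebra.trace_eq_of_algEquiv (fixedAlgEquiv l σ),
      map_mul (fixedAlgEquiv l σ), map_pow, AlgEquiv.apply_symm_apply]
  · intro i j
    have := T.trace_oddSum (C := cyclo (2 ^ m)) i j
    simpa using this
  · intro W hW
    obtain ⟨a, ha⟩ := T.exists_trace_two_sub_mul (C := cyclo (2 ^ m)) hW
    exact ⟨a, by simpa using ha⟩

end

end MixedLattice

/-! ### The ideal, total reality and norms in the compositum -/

namespace MixedLattice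

variable {p l c r m : ℕ} {σ : cyclo p ≃ₐ[ℚ] cyclo p} {lam : ℤ}

section

attribute [local instance] algebraCyclo algebraK algebraL

theorem isIntegral_div_of_mem_moduleI
    (h : ∀ i : Fin l, IsIntegral ℤ (conjX l r lam σ i / conjX l r lam σ 0))
    {a : fieldK l σ} (ha : a ∈ moduleI l r lam σ) : IsIntegral ℤ (a / conjX l r lam σ 0) := by
  obtain ⟨d, rfl⟩ := (Submodule.mem_span_range_iff_exists_fun ℤ).1 ha
  rw [Finset.sum_div]
  refine IsIntegral.sum _ fun i _ => ?_
  rw [smul_div_assoc]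
  exact (h i).smul (d i)

section Compositum

variable [NumberField (fieldK l σ)] [NumberField (fieldL m)] [NumberField (fieldKL l m σ)]
  (T : CompositumSetup (E := fieldKL l m σ) p (2 ^ (m - 2)) l (conjX l r lam σ 0)
      (fun i : Fin l => conjX l r lam σ i) (thetaL m)
      (fun j : Fin (2 ^ (m - 2)) => oddSum (thetaL m) j))

include T

theorem isIntegral_div_of_mem_moduleIOL {y : fieldKL l m σ} (hy : y ∈ moduleIOL l r m lam σ) :
    IsIntegral ℤ (y / xKL l r m lam σ) := by
  refine Submodule.mul_induction_on hy ?_ ?_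
  · rintro _ ⟨a, ha, rfl⟩ _ ⟨b, hb, rfl⟩
    have h1 : IsIntegral ℤ (inclK l m σ (a / conjX l r lam σ 0)) :=
      (isIntegral_div_of_mem_moduleI T.isIntegral_div ha).map (inclK l m σ)
    have h2 : IsIntegral ℤ (inclL l m σ b) := IsIntegral.map (inclL l m σ) hb
    refine (congrArg (IsIntegral ℤ) ?_).mp (h1.mul h2)
    rw [map_div₀, div_mul_eq_mul_div]
    rfl
  · intro y z hy hz
    rw [add_div]
    exact hy.add hz

/-- The s_j are known to be integral, not to generate `O_𝕃`. Equality follows by squeezing: the span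
lies in `𝓘`, `𝓘` lies in the integral multiples of x, and these are already the span. -/
theorem span_prodBasis_eq_moduleIOL :
    Submodule.span ℤ (Set.range (CompositumSetup.prodBasis (fieldKL l m σ)
      (fun i : Fin l => conjX l r lam σ i)
      (fun j : Fin (2 ^ (m - 2)) => oddSum (thetaL m) j))) = moduleIOL l r m lam σ := by
  refine le_antisymm (Submodule.span_le.2 ?_) fun y hy =>
    (T.mem_span_prodBasis_iff y).2 (isIntegral_div_of_mem_moduleIOL T hy)
  rintro _ ⟨ij, rfl⟩
  exact Submodule.mul_mem_mul ⟨conjX l r lam σ ij.1, Submodule.subset_span ⟨ij.1, rfl⟩, rfl⟩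
    ⟨oddSum (thetaL m) ij.2, isIntegral_oddSum T.isIntegral_theta _, rfl⟩

theorem mem_moduleIOL_iff (y : fieldKL l m σ) :
    y ∈ moduleIOL l r m lam σ ↔ IsIntegral ℤ (y / xKL l r m lam σ) := by
  rw [← span_prodBasis_eq_moduleIOL T]
  exact T.mem_span_prodBasis_iff y

theorem xKL_ne_zero : xKL l r m lam σ ≠ 0 :=
  (map_ne_zero (inclK l m σ)).2 T.ne_zero

theorem isPrincipalIdealGeneratedBy_xKL :
    IsPrincipalIdealGeneratedBy (moduleIOL l r m lam σ) (xKL l r m lam σ) := by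
  have hx : IsIntegral ℤ (xKL l r m lam σ) := T.isIntegral_x.map (inclK l m σ)
  have hx0 := xKL_ne_zero T
  refine ⟨⟨xKL l r m lam σ, hx⟩, rfl, ?_⟩
  ext y
  rw [SetLike.mem_coe, mem_moduleIOL_iff T]
  constructor
  · intro hy
    refine ⟨⟨xKL l r m lam σ, hx⟩ * ⟨_, hy⟩, ?_, ?_⟩
    · exact Ideal.mul_mem_right _ _ (Ideal.mem_span_singleton_self _)
    · exact mul_div_cancel₀ y hx0
  · rintro ⟨y, hy, rfl⟩
    obtain ⟨z, rfl⟩ := Ideal.mem_span_singleton.1 hy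
    refine (congrArg (IsIntegral ℤ) ?_).mp z.2
    exact (mul_div_cancel_left₀ (z : fieldKL l m σ) hx0).symm

end Compositum

theorem betaKL_eq_twist [NumberField (fieldKL l m σ)] :
    betaKL l m σ = CompositumSetup.twist p (2 ^ (m - 2)) (fieldKL l m σ) (thetaL m) := by
  have h : algebraMap (fieldL m) (fieldKL l m σ) (2 - thetaL m) = 2 - thetaKL l m σ := by
    rw [map_sub, map_ofNat]
    rfl
  have hk : ((2 : fieldKL l m σ) ^ (m - 2)) ≠ 0 := pow_ne_zero _ two_ne_zero
  rw [CompositumSetup.twist, h, betaKL, eq_ratCast]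
  push_cast
  rw [mul_assoc]
  congr 1
  field_simp

theorem embedding_betaKL_pos (hm : 3 ≤ m) (hp : p ≠ 0) [NumberField (fieldL m)]
    [NumberField (fieldKL l m σ)] (φ : fieldKL l m σ →+* ℝ) : 0 < φ (betaKL l m σ) := by
  have := numberField_cyclo (N := 2 ^ m) (by positivity)
  have h := (twoPowSetup hm).embedding_two_sub_pos
    (φ.comp (algebraMap (fieldL m) (fieldKL l m σ)))
  rw [betaKL_eq_twist, CompositumSetup.twist, map_mul, eq_ratCast, map_ratCast]
  refine mul_pos ?_ h
  positivity

/-- The elements on which φ agrees with its complex conjugate form a subfield; it contains both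
totally real subfields, hence their compositum. -/
theorem conj_embedding_fieldKL (S : CyclicSetup p l c r (zetaGen p) σ) (hm : 3 ≤ m)
    [NumberField (cyclo p)] [IsCyclotomicExtension {p} ℚ (cyclo p)]
    [NumberField (fieldK l σ)] [NumberField (fieldL m)] [NumberField (fieldKL l m σ)]
    (φ : fieldKL l m σ →+* ℂ) (y : fieldKL l m σ) : (starRingEnd ℂ) (φ y) = φ y := by
  have := numberField_cyclo (N := 2 ^ m) (by positivity)
  let F : IntermediateField ℚ (fieldKL l m σ) :=
    (((starRingEnd ℂ).comp φ).eqLocusField φ).toIntermediateField fun q => by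
      change (starRingEnd ℂ) (φ _) = φ _
      rw [eq_ratCast, map_ratCast, map_ratCast]
  suffices h : (⊤ : IntermediateField ℚ (fieldKL l m σ)) ≤ F from h (IntermediateField.mem_top)
  rw [← fieldRange_sup_fieldRange]
  refine sup_le ?_ ?_
  · rintro _ ⟨a, rfl⟩
    have h := S.conj_embedding ((φ.comp (algebraMap (fieldK l σ) (fieldKL l m σ))).comp
      (fixedEquiv l σ : fixedK l σ →+* fieldK l σ)) ((fixedEquiv l σ).symm a)
    simp only [RingHom.comp_apply, RingHom.coe_coe, RingEquiv.apply_symm_apply] at h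
    exact h
  · rintro _ ⟨b, rfl⟩
    exact (twoPowSetup hm).conj_embedding (φ.comp (algebraMap (fieldL m) (fieldKL l m σ))) b

section Norms

variable [NumberField (fieldK l σ)] [NumberField (fieldL m)] [NumberField (fieldKL l m σ)]
  (T : CompositumSetup (E := fieldKL l m σ) p (2 ^ (m - 2)) l (conjX l r lam σ 0)
      (fun i : Fin l => conjX l r lam σ i) (thetaL m)
      (fun j : Fin (2 ^ (m - 2)) => oddSum (thetaL m) j))

include T in
theorem norm_xKL_sq [NumberField (cyclo p)] [IsCyclotomicExtension {p} ℚ (cyclo p)]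
    (S : CyclicSetup p l c r (zetaGen p) σ)
    (hlam : lam * ((r : ℤ) - 1) ≡ 1 [ZMOD p])
    (hu : IsIntegral ℤ (σ (xElt l r lam σ : cyclo p) / (xElt l r lam σ : cyclo p))) :
    (Algebra.norm ℚ (xKL l r m lam σ)) ^ 2 = (p : ℚ) ^ (2 ^ (m - 2) * l + 2 ^ (m - 2)) := by
  rw [xElt_eq S] at hu
  have h1 : Algebra.norm ℚ (xKL l r m lam σ) =
      Algebra.norm ℚ (conjX l r lam σ 0) ^ 2 ^ (m - 2) := T.norm_K _
  have h2 : Algebra.norm ℚ (conjX l r lam σ 0) =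
      Algebra.norm ℚ (CyclicSetup.traceElt l c r (zetaGen p) σ lam) := by
    rw [← fixedAlgEquiv_conj S]
    exact Algebra.norm_eq_of_algEquiv _ _
  rw [h1, h2, ← pow_mul, mul_comm, pow_mul, S.norm_traceElt_sq hlam hu, ← pow_mul]
  congr 1
  ring

include T in
-- The norm of 2 - θ is known only up to sign; positivity of all real embeddings of β selects the
-- root.
theorem norm_betaKL (hm : 3 ≤ m) (s : Fin (2 ^ (m - 2) * l) ≃ (fieldKL l m σ →+* ℝ)) :
    (Algebra.norm ℚ (betaKL l m σ) : ℚ) =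
      (((p : ℚ) ^ 2)⁻¹ * (2 * ((2 ^ (m - 2) : ℕ) : ℚ))⁻¹) ^ (2 ^ (m - 2) * l) * 2 ^ l := by
  have := numberField_cyclo (N := 2 ^ m) (by positivity)
  have := isCyclotomicExtension_cyclo (N := 2 ^ m) (by positivity)
  have hp : p ≠ 0 := T.odd.pos.ne'
  have hpos : 0 < (Algebra.norm ℚ (betaKL l m σ) : ℚ) := by
    have h := prod_embeddings_eq_norm T.finrank_eq s (betaKL l m σ)
    have h2 : 0 < ∏ i, s i (betaKL l m σ) :=
      Finset.prod_pos fun i _ => embedding_betaKL_pos hm hp _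
    rw [h] at h2
    exact_mod_cast h2
  refine (sq_eq_sq₀ hpos.le (by positivity)).1 ?_
  rw [betaKL_eq_twist, CompositumSetup.twist, map_mul, Algebra.norm_algebraMap, T.norm_L,
    T.finrank_eq, mul_pow, mul_pow _ ((2 : ℚ) ^ l)]
  congr 1
  rw [← pow_mul, mul_comm, pow_mul, (twoPowSetup hm).norm_two_sub_sq (C := cyclo (2 ^ m)),
    ← pow_mul, mul_comm, pow_mul]
  norm_num

end Norms

end

end MixedLattice

/-! ### Half-integral exponents and the theorem -/

namespace MixedLattice

theorem abs_eq_rpow_of_sq_eq {a : ℚ} {p k l : ℕ} (h : a ^ 2 = (p : ℚ) ^ (k * l + k)) :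
    (|a| : ℝ) = (p : ℝ) ^ ((((k * l : ℕ) : ℝ) + k) / 2) := by
  have h1 : (a : ℝ) ^ 2 = (p : ℝ) ^ (k * l + k) := by exact_mod_cast h
  refine (sq_eq_sq₀ (abs_nonneg _) (by positivity)).1 ?_
  rw [sq_abs, h1, ← Real.rpow_natCast, ← Real.rpow_natCast, ← Real.rpow_mul (by positivity)]
  congr 1
  push_cast
  ring

theorem rpow_half_sq {a : ℝ} (ha : 0 < a) (t : ℝ) : (a ^ (t / 2)) ^ 2 = a ^ t := by
  rw [← Real.rpow_natCast, ← Real.rpow_mul ha.le, Nat.cast_ofNat, div_mul_cancel₀ _ two_ne_zero]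

/-- Both sides are nonnegative, so squares may be compared; this removes the root and the half
exponents, leaving the power of p as p^(-2n) p^(n+k). -/
theorem sqrt_mul_abs_eq {a b : ℚ} {p l m : ℕ} (hp : 0 < p) (hm : 3 ≤ m)
    (ha : a ^ 2 = (p : ℚ) ^ (2 ^ (m - 2) * l + 2 ^ (m - 2)))
    (hb : b = (((p : ℚ) ^ 2)⁻¹ * (2 * ((2 ^ (m - 2) : ℕ) : ℚ))⁻¹) ^ (2 ^ (m - 2) * l) * 2 ^ l) :
    √(b : ℝ) * |(a : ℝ)| =
      (p : ℝ) ^ ((((2 ^ (m - 2) : ℕ) : ℝ) - ((2 ^ (m - 2) * l : ℕ) : ℝ)) / 2) *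
        (2 : ℝ) ^ (((l : ℝ) - ((2 ^ (m - 2) * l : ℕ) : ℝ) * ((m : ℝ) - 1)) / 2) := by
  have hp0 : (0 : ℝ) < p := by exact_mod_cast hp
  have h1 : (a : ℝ) ^ 2 = (p : ℝ) ^ (2 ^ (m - 2) * l + 2 ^ (m - 2)) := by exact_mod_cast ha
  have h2 : (2 : ℚ) * ((2 ^ (m - 2) : ℕ) : ℚ) = 2 ^ (m - 1) := by
    push_cast
    rw [← pow_succ']
    congr 1
    omega
  rw [h2] at hb
  set k := 2 ^ (m - 2)
  have h3 : (b : ℝ) = (((p : ℝ) ^ 2)⁻¹ * ((2 : ℝ) ^ (m - 1))⁻¹) ^ (k * l) * 2 ^ l := by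
    rw [hb]
    push_cast
    rfl
  have h4 : (((m - 1 : ℕ) : ℝ)) = (m : ℝ) - 1 := by
    rw [Nat.cast_sub (by omega), Nat.cast_one]
  refine (sq_eq_sq₀ (by positivity) (by positivity)).1 ?_
  rw [mul_pow, mul_pow, Real.sq_sqrt (by rw [h3]; positivity), sq_abs, h1, h3,
    rpow_half_sq hp0, rpow_half_sq two_pos, Real.rpow_sub hp0, Real.rpow_sub two_pos, ← h4,
    ← Nat.cast_mul]
  simp only [Real.rpow_natCast]
  rw [mul_pow, inv_pow, inv_pow, ← pow_mul, ← pow_mul, mul_comm (m - 1)]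
  field_simp
  ring

end MixedLattice

theorem mainTheorem4
    (l m p r k n : ℕ) (lam : ℤ)
    (hl : Odd l) (hl1 : 1 < l) (hm : 3 ≤ m) (hk : k = 2 ^ (m - 2)) (hn : n = k * l)
    (hp : p.Prime) (hpl : p ≡ 1 [MOD l])
    (hr : orderOf (r : ZMod p) = p - 1)
    (hlam : lam * ((r : ℤ) - 1) ≡ 1 [ZMOD p])
    (σ : MixedLattice.cyclo p ≃ₐ[ℚ] MixedLattice.cyclo p)
    (hσ : σ (MixedLattice.zetaGen p) = MixedLattice.zetaGen p ^ r)
    (hu : σ (MixedLattice.xElt l r lam σ : MixedLattice.cyclo p) /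
        (MixedLattice.xElt l r lam σ : MixedLattice.cyclo p) ∈
      Algebra.adjoin ℤ {MixedLattice.zetaGen p}) :
    MixedLattice.IsPrincipalIdealGeneratedBy
        (MixedLattice.moduleIOL l r m lam σ) (MixedLattice.xKL l r m lam σ) ∧
    Module.finrank ℚ (MixedLattice.fieldKL l m σ) = n ∧
    Nonempty (Fin n ≃ (MixedLattice.fieldKL l m σ →+* ℝ)) ∧
    (∀ s : Fin n ≃ (MixedLattice.fieldKL l m σ →+* ℝ),
      MixedLattice.IsRotatedVersion
        (MixedLattice.algebraicLattice s (MixedLattice.betaKL l m σ)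
          (MixedLattice.moduleIOL l r m lam σ))
        (MixedLattice.cubicLattice n) ∧
      MixedLattice.HasMaximumDiversity
        (MixedLattice.algebraicLattice s (MixedLattice.betaKL l m σ)
          (MixedLattice.moduleIOL l r m lam σ)) ∧
      MixedLattice.minProductDistance
        (MixedLattice.algebraicLattice s (MixedLattice.betaKL l m σ)
          (MixedLattice.moduleIOL l r m lam σ)) =
        (p : ℝ) ^ (((k : ℝ) - n) / 2) * (2 : ℝ) ^ (((l : ℝ) - n * ((m : ℝ) - 1)) / 2)) ∧
    (|(Algebra.norm ℚ (MixedLattice.xKL l r m lam σ) : ℚ)| : ℝ) =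
      (p : ℝ) ^ (((n : ℝ) + k) / 2) := by
  obtain ⟨c, S⟩ := MixedLattice.exists_cyclicSetup hl hl1 hp hpl hr σ hσ
  have hcyc := MixedLattice.isCyclotomicExtension_cyclo hp.ne_zero
  have hnum := MixedLattice.numberField_cyclo hp.ne_zero
  have hK : NumberField (MixedLattice.fieldK l σ) := MixedLattice.numberField_fieldK
  have hL := MixedLattice.numberField_fieldL m
  have hKL : NumberField (MixedLattice.fieldKL l m σ) := MixedLattice.numberField_fieldKL
  let := MixedLattice.algebraK l m σ
  let := MixedLattice.algebraL l m σ
  -- Membership in ℤ[ζ] enters only through integrality of the ratio.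
  have hint : IsIntegral ℤ (σ (MixedLattice.xElt l r lam σ : MixedLattice.cyclo p) /
      (MixedLattice.xElt l r lam σ : MixedLattice.cyclo p)) :=
    adjoin_le_integralClosure
      ((MixedLattice.isPrimitiveRoot_zetaGen hp.ne_zero).isIntegral hp.pos) hu
  have T := MixedLattice.compositumSetup S hm hlam hint
  subst hk hn
  have hN := MixedLattice.norm_xKL_sq T S hlam hint
  have hpos := MixedLattice.embedding_betaKL_pos (l := l) (σ := σ) hm hp.ne_zero
  have hn0 : 0 < 2 ^ (m - 2) * l := by positivity
  refine ⟨MixedLattice.isPrincipalIdealGeneratedBy_xKL T, T.finrank_eq,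
    MixedLattice.nonempty_equiv_real_embeddings T.finrank_eq
      (MixedLattice.conj_embedding_fieldKL S hm), fun s => ⟨?_, ?_, ?_⟩, ?_⟩
  · rw [← MixedLattice.span_prodBasis_eq_moduleIOL T]
    refine MixedLattice.isRotatedVersion_algebraicLattice T.finrank_eq hn0 s
      (fun i => hpos (s i)) _ (T.card_eq.trans T.finrank_eq) fun i j => ?_
    rw [MixedLattice.betaKL_eq_twist]
    exact T.trace_prodBasis i j
  · exact MixedLattice.hasMaximumDiversity_algebraicLattice s (fun i => hpos (s i)) _
  · rw [MixedLattice.minProductDistance_algebraicLattice T.finrank_eq s hn0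
      (fun i => hpos (s i)) _ (MixedLattice.xKL_ne_zero T) (MixedLattice.mem_moduleIOL_iff T)]
    exact MixedLattice.sqrt_mul_abs_eq hp.pos hm hN (MixedLattice.norm_betaKL T hm s)
  · exact MixedLattice.abs_eq_rpow_of_sq_eq hN
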